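/- **KdV hierarchy.** Let $\mathcal A=\mathbb Q[u_0,u_1,u_2,\dots]$ with the derivation $\partial(u_i)=u_{i+1}$. Let $b_{-1}=1,\ b_0=u_0,\ b_1,\dots\in\mathcal A$ be the coefficients of the unique series $b(\lambda)=\sum_{k\ge -1}b_k\lambda^{-k-1}=1+O(\lambda^{-1})$ with $b\,\partial^2 b-\tfrac12(\partial b)^2-2(\lambda-2u_0)b^2=-2\lambda$. The KdV derivations $D_k$ $(k\ge 0)$ of $\mathcal A$ are the derivations that commute with $\partial$ and satisfy $D_k(u_0)=\partial(b_k)/(2k+1)!!$; thus $D_0=\partial$ and $D_1(u_0)=u_0u_1+\tfrac1{12}u_3$. The canonical tau-structure is the family $\Omega_{p,q}\in\mathcal A$ $(p,q\ge0)$ with $\Omega_{0,0}=u_0$, $\Omega_{p,q}=\Omega_{q,p}$, $D_r\Omega_{p,q}=D_q\Omega_{p,r}$ for all $p,q,r\ge 0$, all $\Omega_{p,q}$ vanishing at $u_0=u_1=\cdots=0$. For $n\ge 3$ put $\Omega_{p_1,\dots,p_n}=D_{p_1}\cdots D_{p_{n-2}}\Omega_{p_{n-1},p_n}$. **Solutions.**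 Let $\widetilde V$ be a commutative $\mathbb Q$-algebra with a derivation $\partial_x$, and $V\subseteq\widetilde V$ a subring closed under $\partial_x$ with $V\subseteq\partial_x(\widetilde V)$. Write $\mathbf t=(t_0=x,t_1,t_2,\dots)$, $\mathbf t_{>0}=(t_1,t_2,\dots)$. A solution of the KdV hierarchy is $u=u(\mathbf t)\in V[[\mathbf t_{>0}]]$ with $\partial u/\partial t_k=D_k(u_0)|_{u_i=\partial_x^i u}$ for all $k\ge 0$. Its $n$-point correlation functions $\Omega_{p_1,\dots,p_n}(\mathbf t)$ $(n\ge2)$ are the images of $\Omega_{p_1,\dots,p_n}$ under $u_i\mapsto\partial_x^i u$. **Wave functions.** Let $L=\partial_x^2+2u$, let $A_k=\frac1{(2k+1)!!}\bigl(L^{(2k+1)/2}\bigr)_+$ with formal adjoint $A_k^*$, and put $\theta(z)=\sum_{k\ge0}t_kz^{2k+1}/(2k+1)!!$. A wave function of $u$ is $\psi=(1+\phi_1(\mathbf t)/z+\phi_2(\mathbf t)/z^2+\cdots)\,e^{\theta(z)}$ with $\phi_m\in\widetilde V[[\mathbf t_{>0}]]$, satisfying $L\psi=z^2\psi$ and $\partial_{t_k}\psi=A_k\psi$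 for all $k\ge0$. The dual wave function associated with $\psi$ is $\psi^*=(1+\phi_1^*(\mathbf t)/z+\phi^*_2(\mathbf t)/z^2+\cdots)\,e^{-\theta(z)}$ with $\phi_m^*\in\widetilde V[[\mathbf t_{>0}]]$, satisfying $L\psi^*=z^2\psi^*$, $-\partial_{t_k}\psi^*=A_k^*\psi^*$ for all $k\ge 0$, and such that $\partial_x^i(\psi)\,\psi^*$ has residue $0$ at $z=\infty$ for all $i\ge0$. Put $$D(z,w,\mathbf t)=\frac{\psi(z,\mathbf t)\,\psi^*_x(w,\mathbf t)-\psi^*(w,\mathbf t)\,\psi_x(z,\mathbf t)}{w^2-z^2}.$$ **Theorem.** Let $u(\mathbf t)$ be any solution of the KdV hierarchy and $(\psi,\psi^*)$ any pair consisting of a wave function of $u$ and the dual wave function associated with it. Then for every $n\ge2$ $$\sum_{p_1,\dots,p_n\ge0}\Omega_{p_1,\dots,p_n}(\mathbf t)\prod_{j=1}^n\frac{(2p_j+1)!!}{z_j^{2p_j+2}}=(-1)^{n-1}\sum_{\sigma\in S_n/C_n}\ \prod_{i=1}^nD\bigl(z_{\sigma(i)},z_{\sigma(i+1)},\mathbf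 t\bigr)-\frac{\delta_{n,2}}{(z_1-z_2)^2},$$ where $C_n$ is the cyclic group and $\sigma(n+1)=\sigma(1)$. (The identity holds in the total ring of fractions of $\widetilde V[[\mathbf t_{>0}]][[z_1^{-1},\dots,z_n^{-1}]]$; the exponential factors cancel in each product.) -/

import Mathlib

open Finset

noncomputable section

namespace KdV

/-! ### Differential polynomials and the abstract KdV hierarchy -/

/-- The ring `ℚ[u₀, u₁, u₂, …]` of differential polynomials. -/
abbrev DiffPoly : Type := MvPolynomial ℕ ℚ

/-- The variable `u i`, standing for the `i`-th `x`-derivative of `u`. -/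
abbrev uVar (i : ℕ) : DiffPoly := MvPolynomial.X i

/-- The derivation `∂` of `ℚ[u₀, u₁, …]` with `∂ (u i) = u (i + 1)`. -/
def dPoly : Derivation ℚ DiffPoly DiffPoly :=
  MvPolynomial.mkDerivation ℚ fun i => uVar (i + 1)

/-- The differential polynomials `b_{-1}, b_0, b_1, …`, with the index shifted by one:
`resolventCoeff m = b_{m-1}`. The series `b(λ) = ∑_{k ≥ -1} b_k λ^{-k-1} = 1 + u₀ / λ + ⋯` is the
solution of `b ∂²b - (∂b)² / 2 - 2 (λ - 2 u₀) b² = -2 λ`; the recursion below is the comparison of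
the coefficients in this equation. -/
def resolventCoeff : ℕ → DiffPoly
  | 0 => 1
  | m + 1 =>
    (∑ i : Fin (m + 1),
      (MvPolynomial.C (1 / 4 : ℚ) * (resolventCoeff i * dPoly (dPoly (resolventCoeff (m - i))))
        - MvPolynomial.C (1 / 8 : ℚ) * (dPoly (resolventCoeff i) * dPoly (resolventCoeff (m - i)))
        + uVar 0 * (resolventCoeff i * resolventCoeff (m - i))))
    - MvPolynomial.C (1 / 2 : ℚ) *
        ∑ i : Fin m, resolventCoeff (i + 1) * resolventCoeff (m - i)
  decreasing_by all_goals omega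

/-- The KdV derivation `D_k`: it commutes with `∂` and `D_k (u₀) = ∂ (b_k) / (2k+1)!!`,
that is, `D_k (u_i) = ∂^{i+1} (b_k) / (2k+1)!!`. -/
def kdvDer (k : ℕ) : Derivation ℚ DiffPoly DiffPoly :=
  MvPolynomial.mkDerivation ℚ fun i =>
    MvPolynomial.C (1 / (Nat.doubleFactorial (2 * k + 1) : ℚ)) *
      dPoly^[i + 1] (resolventCoeff (k + 1))

theorem kdvDer_dPoly (k : ℕ) (p : DiffPoly) : kdvDer k (dPoly p) = dPoly (kdvDer k p) := by
  have h : ⁅kdvDer k, dPoly⁆ = 0 := by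
    apply MvPolynomial.derivation_ext
    intro i
    simp [Derivation.commutator_apply, kdvDer, dPoly, MvPolynomial.mkDerivation_X,
      ← MvPolynomial.algebraMap_eq, Function.iterate_succ_apply']
  have h2 := DFunLike.congr_fun h p
  simpa [Derivation.commutator_apply, sub_eq_zero] using h2

/-- `Ω` is the canonical tau-structure of the KdV hierarchy: `Ω_{0,0} = u₀`, `Ω_{p,q} = Ω_{q,p}`,
`D_r Ω_{p,q} = D_q Ω_{p,r}`, and all `Ω_{p,q}` vanish at `u₀ = u₁ = ⋯ = 0`. -/
structure IsCanonicalTauStructure (Ω : ℕ → ℕ → DiffPoly) : Prop where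
  zero_zero : Ω 0 0 = uVar 0
  symm : ∀ p q, Ω p q = Ω q p
  der : ∀ p q r, kdvDer r (Ω p q) = kdvDer q (Ω p r)
  vanish : ∀ p q, MvPolynomial.constantCoeff (Ω p q) = 0

/-- `Ω_{p₁,…,pₙ} = D_{p₁} ⋯ D_{p_{n-2}} (Ω_{p_{n-1},p_n})` for a list of `n ≥ 2` indices
(and `0` for shorter lists). -/
def multiOmega (Ω : ℕ → ℕ → DiffPoly) : List ℕ → DiffPoly
  | [] => 0
  | [_] => 0
  | [p, q] => Ω p q
  | p :: q :: r :: l => kdvDer p (multiOmega Ω (q :: r :: l))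

/-! ### Pseudo-differential operators over the differential polynomials -/

/-- The formal pseudo-differential operator `∑_{m ≥ 0} coeff m ∂^{order - m}`. -/
structure PseudoDiffOp where
  /-- an upper bound of the exponents of `∂` -/
  order : ℤ
  /-- the coefficient of `∂^{order - m}` -/
  coeff : ℕ → DiffPoly

/-- The coefficient of `∂ ^ j`. -/
def PseudoDiffOp.coeffAt (P : PseudoDiffOp) (j : ℤ) : DiffPoly :=
  if j ≤ P.order then P.coeff (P.order - j).toNat else 0

/-- Composition, by the rule `∂^d ∘ f = ∑_{l ≥ 0} binom(d, l) ∂^l(f) ∂^{d-l}` for `d ∈ ℤ`. -/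
def PseudoDiffOp.comp (P Q : PseudoDiffOp) : PseudoDiffOp where
  order := P.order + Q.order
  coeff m := ∑ i ∈ range (m + 1), ∑ j ∈ range (m + 1 - i),
    Ring.choose (P.order - i) (m - i - j) • (P.coeff i * dPoly^[m - i - j] (Q.coeff j))

/-- The identity operator. -/
def PseudoDiffOp.one : PseudoDiffOp where
  order := 0
  coeff m := if m = 0 then 1 else 0

/-- Powers with respect to composition. -/
def PseudoDiffOp.pow (P : PseudoDiffOp) : ℕ → PseudoDiffOp
  | 0 => PseudoDiffOp.one
  | n + 1 => P.comp (P.pow n)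

/-- The Lax operator `L = ∂² + 2 u₀`. -/
def laxOp : PseudoDiffOp where
  order := 2
  coeff m := if m = 0 then 1 else if m = 2 then 2 * uVar 0 else 0

/-- The coefficients of the square root `L^{1/2} = ∂ + ⋯` of the Lax operator, determined one after
the other by `L^{1/2} ∘ L^{1/2} = L`. -/
def sqrtLaxCoeff : ℕ → DiffPoly
  | 0 => 1
  | m + 1 => MvPolynomial.C (1 / 2 : ℚ) * (laxOp.coeff (m + 1)
      - ∑ i : Fin (m + 1), ∑ j : Fin (m + 1), if (i : ℕ) + j ≤ m + 1 then
          Ring.choose (1 - (i : ℕ) : ℤ) (m + 1 - i - j) •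
            (sqrtLaxCoeff i * dPoly^[m + 1 - i - j] (sqrtLaxCoeff j))
        else 0)
  decreasing_by all_goals omega

/-- The square root `L^{1/2} = ∂ + ⋯` of the Lax operator. -/
def sqrtLax : PseudoDiffOp where
  order := 1
  coeff := sqrtLaxCoeff

theorem sqrtLax_comp_self : sqrtLax.comp sqrtLax = laxOp := by
  have hc : (sqrtLax.comp sqrtLax).coeff = laxOp.coeff := by
    funext m
    cases m with
    | zero => simp [PseudoDiffOp.comp, sqrtLax, sqrtLaxCoeff, laxOp]
    | succ m =>
      set g : ℕ → ℕ → DiffPoly := fun i j => if i + j ≤ m + 1 then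
        Ring.choose (1 - (i : ℕ) : ℤ) (m + 1 - i - j) •
          (sqrtLaxCoeff i * dPoly^[m + 1 - i - j] (sqrtLaxCoeff j)) else 0 with hg
      have h1 : (sqrtLax.comp sqrtLax).coeff (m + 1) =
          ∑ i ∈ range (m + 2), ∑ j ∈ range (m + 2), g i j := by
        change ∑ i ∈ range (m + 1 + 1), ∑ j ∈ range (m + 1 + 1 - i),
          Ring.choose (1 - (i : ℕ) : ℤ) (m + 1 - i - j) •
            (sqrtLaxCoeff i * dPoly^[m + 1 - i - j] (sqrtLaxCoeff j)) = _
        refine Finset.sum_congr rfl fun i hi => ?_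
        rw [Finset.mem_range] at hi
        rw [← Finset.sum_subset (s₁ := range (m + 1 + 1 - i))
          (Finset.range_subset_range.2 (Nat.sub_le _ _))]
        · refine Finset.sum_congr rfl fun j hj => ?_
          rw [Finset.mem_range] at hj
          simp only [hg]
          rw [if_pos (by omega)]
        · intro j _ hj
          rw [Finset.mem_range] at hj
          simp only [hg]
          rw [if_neg (by omega)]
      have h2 : sqrtLaxCoeff (m + 1) = MvPolynomial.C (1 / 2 : ℚ) * (laxOp.coeff (m + 1)
          - ∑ i ∈ range (m + 1), ∑ j ∈ range (m + 1), g i j) := by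
        rw [sqrtLaxCoeff, Finset.sum_range]
        simp only [Finset.sum_range, hg]
      have h3 : ∀ i, i ≤ m → g i (m + 1) = if i = 0 then sqrtLaxCoeff (m + 1) else 0 := by
        intro i _
        by_cases h : i = 0
        · subst h; simp [hg, sqrtLaxCoeff]
        · simp only [hg]; rw [if_neg (by omega), if_neg h]
      have h4 : ∀ j, g (m + 1) j = if j = 0 then sqrtLaxCoeff (m + 1) else 0 := by
        intro j
        by_cases h : j = 0
        · subst h; simp [hg, sqrtLaxCoeff]
        · simp only [hg]; rw [if_neg (by omega), if_neg h]
      have h5 : ∑ i ∈ range (m + 1), g i (m + 1) = sqrtLaxCoeff (m + 1) := by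
        rw [Finset.sum_congr rfl fun i hi => h3 i (by rw [Finset.mem_range] at hi; omega)]
        simp
      have h6 : ∑ j ∈ range (m + 2), g (m + 1) j = sqrtLaxCoeff (m + 1) := by
        rw [Finset.sum_congr rfl fun j _ => h4 j]
        simp
      have h7 : (MvPolynomial.C (1 / 2 : ℚ) : DiffPoly) * 2 = 1 := by
        rw [show (2 : DiffPoly) = MvPolynomial.C 2 from (map_ofNat MvPolynomial.C 2).symm,
          ← map_mul]
        norm_num
      rw [h1, Finset.sum_range_succ, h6]
      simp only [Finset.sum_range_succ _ (m + 1)]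
      rw [Finset.sum_add_distrib, h5]
      linear_combination 2 * h2 + (laxOp.coeff (m + 1)
        - ∑ i ∈ range (m + 1), ∑ j ∈ range (m + 1), g i j) * h7
  calc sqrtLax.comp sqrtLax
      = ⟨(sqrtLax.comp sqrtLax).order, (sqrtLax.comp sqrtLax).coeff⟩ := rfl
    _ = laxOp := by rw [hc]; rfl

/-- The coefficient of `∂ ^ j` (`0 ≤ j ≤ 2k+1`) in the differential operator
`A_k = (L^{(2k+1)/2})_+ / (2k+1)!!`. -/
def laxACoeff (k j : ℕ) : DiffPoly :=
  MvPolynomial.C (1 / (Nat.doubleFactorial (2 * k + 1) : ℚ)) *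
    (sqrtLax.pow (2 * k + 1)).coeffAt j

/-! ### Solutions of the KdV hierarchy -/

/-- The ring `W⟦t₁, t₂, …⟧` of formal power series in the higher times `t_k`, `k ≥ 1`. -/
abbrev TimeSeries (W : Type*) : Type _ := MvPowerSeries ℕ+ W

section Solutions

variable {W : Type*} [CommRing W] [Algebra ℚ W]

/-- The derivation `∂ / ∂x` of `W⟦t₁, t₂, …⟧`: the derivation `δ` of `W` applied to the
coefficients. -/
def xDer (δ : Derivation ℚ W W) : Derivation ℚ (TimeSeries W) (TimeSeries W) :=
  Derivation.mk'
    { toFun := fun f => (fun m => δ (MvPowerSeries.coeff m f) : TimeSeries W)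
      map_add' := by
        intro f g; ext m
        exact (congrArg δ (map_add (MvPowerSeries.coeff m) f g)).trans (map_add δ _ _)
      map_smul' := by
        intro c f; ext m
        exact δ.map_smul c (MvPowerSeries.coeff m f) }
    (by
      classical
      intro f g; ext m
      change δ (MvPowerSeries.coeff m (f * g)) = MvPowerSeries.coeff m (f * _ + g * _)
      rw [map_add, MvPowerSeries.coeff_mul, MvPowerSeries.coeff_mul, mul_comm g,
        MvPowerSeries.coeff_mul, map_sum, ← Finset.sum_add_distrib]
      refine Finset.sum_congr rfl fun p _ => ?_
      rw [Derivation.leibniz, smul_eq_mul, smul_eq_mul,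
        mul_comm (MvPowerSeries.coeff p.2 g)]
      rfl)

/-- The derivation `∂ / ∂t_k` of `W⟦t₁, t₂, …⟧`, where `t₀ = x`. -/
def timeDer (δ : Derivation ℚ W W) : ℕ → Derivation ℚ (TimeSeries W) (TimeSeries W)
  | 0 => xDer δ
  | k + 1 => (MvPowerSeries.pderiv W k.succPNat).restrictScalars ℚ

/-- The value of a differential polynomial at `u = u(t)`: substitute `∂_x^i (u)` for `u i`. -/
def evalAt (δ : Derivation ℚ W W) (u : TimeSeries W) : DiffPoly →ₐ[ℚ] TimeSeries W :=
  MvPolynomial.aeval fun i => (xDer δ)^[i] u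

/-- `u` solves the KdV hierarchy: `∂u/∂t_k = D_k(u₀)`, evaluated at `u`, for all `k ≥ 0`. -/
def IsSolution (δ : Derivation ℚ W W) (u : TimeSeries W) : Prop :=
  ∀ k, timeDer δ k u = evalAt δ u (kdvDer k (uVar 0))

/-! ### Wave functions

Put `θ(z) = ∑_{k ≥ 0} t_k z^{2k+1} / (2k+1)!!`. A formal Laurent series `a` in `1 / z` (the variable
of `LaurentSeries` is `1 / z`) stands for the element `a e^{ε θ(z)}` of the module
`W⟦t₁, t₂, …⟧((1/z)) e^{ε θ(z)}`, where `ε = 1` for wave functions and `ε = -1` for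
dual wave functions. -/

/-- The power `z ^ m`, as a Laurent series in `1 / z`. -/
def zPow (m : ℤ) : LaurentSeries (TimeSeries W) := HahnSeries.single (-m) 1

/-- `∂ / ∂t_k` on `W⟦t₁, t₂, …⟧((1/z)) e^{ε θ(z)}`: it is
`a e^{ε θ} ↦ (∂a/∂t_k + ε z^{2k+1} / (2k+1)!! a) e^{ε θ}`. -/
def expDer (δ : Derivation ℚ W W) (ε : ℤ) (k : ℕ) (a : LaurentSeries (TimeSeries W)) :
    LaurentSeries (TimeSeries W) :=
  a.map (timeDer δ k) +
    HahnSeries.C (algebraMap ℚ (TimeSeries W) (ε / (Nat.doubleFactorial (2 * k + 1) : ℚ))) *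
      (zPow (2 * k + 1) * a)

/-- The series has the form `1 + φ₁ / z + φ₂ / z² + ⋯`. -/
def HasUnitForm (a : LaurentSeries (TimeSeries W)) : Prop :=
  a.coeff 0 = 1 ∧ ∀ m < 0, a.coeff m = 0

/-- The Lax operator `L = ∂_x² + 2u` of `u`, acting on `W⟦t₁, t₂, …⟧((1/z)) e^{ε θ(z)}`. -/
def laxAct (δ : Derivation ℚ W W) (u : TimeSeries W) (ε : ℤ) (a : LaurentSeries (TimeSeries W)) :
    LaurentSeries (TimeSeries W) :=
  expDer δ ε 0 (expDer δ ε 0 a) + HahnSeries.C (2 * u) * a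

/-- The operator `A_k` of `u`, acting on `W⟦t₁, t₂, …⟧((1/z)) e^{ε θ(z)}`. -/
def laxAAct (δ : Derivation ℚ W W) (u : TimeSeries W) (ε : ℤ) (k : ℕ)
    (a : LaurentSeries (TimeSeries W)) : LaurentSeries (TimeSeries W) :=
  ∑ j ∈ range (2 * k + 2), HahnSeries.C (evalAt δ u (laxACoeff k j)) * (expDer δ ε 0)^[j] a

/-- The formal adjoint `A_k^*` of the operator `A_k` of `u`, acting on
`W⟦t₁, t₂, …⟧((1/z)) e^{ε θ(z)}`: the adjoint of `∑ a_j ∂_x^j` is `∑ (-∂_x)^j ∘ a_j`. -/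
def laxAAdjointAct (δ : Derivation ℚ W W) (u : TimeSeries W) (ε : ℤ) (k : ℕ)
    (a : LaurentSeries (TimeSeries W)) : LaurentSeries (TimeSeries W) :=
  ∑ j ∈ range (2 * k + 2),
    (-1) ^ j * (expDer δ ε 0)^[j] (HahnSeries.C (evalAt δ u (laxACoeff k j)) * a)

/-- `ψ = a e^{θ(z)}` is a wave function of `u`. -/
structure IsWaveFunction (δ : Derivation ℚ W W) (u : TimeSeries W)
    (a : LaurentSeries (TimeSeries W)) : Prop where
  unitForm : HasUnitForm a
  lax : laxAct δ u 1 a = zPow 2 * a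
  time : ∀ k, expDer δ 1 k a = laxAAct δ u 1 k a

/-- `ψ* = b e^{-θ(z)}` is the dual wave function of `u` associated with `ψ = a e^{θ(z)}`. The last
condition is that `∂_x^i(ψ) ψ*` has residue zero at `z = ∞`, i.e. that its coefficient of `1 / z`
vanishes. -/
structure IsDualWaveFunction (δ : Derivation ℚ W W) (u : TimeSeries W)
    (a b : LaurentSeries (TimeSeries W)) : Prop where
  unitForm : HasUnitForm b
  lax : laxAct δ u (-1) b = zPow 2 * b
  time : ∀ k, - expDer δ (-1) k b = laxAAdjointAct δ u (-1) k b
  residue : ∀ i, ((expDer δ 1 0)^[i] a * b).coeff 1 = 0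

/-- `(ψ, ψ*) = (a e^{θ(z)}, b e^{-θ(z)})` is a pair of wave functions of `u`. -/
def IsWavePair (δ : Derivation ℚ W W) (u : TimeSeries W)
    (a b : LaurentSeries (TimeSeries W)) : Prop :=
  IsWaveFunction δ u a ∧ IsDualWaveFunction δ u a b

end Solutions

/-! ### Series in `n` spectral variables -/

section Spectral

variable {R : Type*} [CommRing R] {n : ℕ}

variable (R n) in
/-- The total ring of fractions of the power series ring `R⟦1/z₁, …, 1/zₙ⟧` (the variables of the
power series are `1/z₁, …, 1/zₙ`). It contains the `z_i`, and `1 / (z_i² - z_j²)` for `i ≠ j`. -/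
abbrev SpecRing : Type _ := FractionRing (MvPowerSeries (Fin n) R)

/-- A power series in `1/z`, read as a power series in `1/z_i`. -/
def powerSeriesAt (i : Fin n) : PowerSeries R →+* SpecRing R n :=
  (algebraMap (MvPowerSeries (Fin n) R) (SpecRing R n)).comp
    (MvPowerSeries.rename (R := R) (fun _ : Unit => i)).toRingHom

theorem powerSeriesAt_X (i : Fin n) :
    powerSeriesAt i (PowerSeries.X : PowerSeries R) =
      algebraMap (MvPowerSeries (Fin n) R) (SpecRing R n) (MvPowerSeries.X i) := by
  change algebraMap (MvPowerSeries (Fin n) R) (SpecRing R n)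
    (MvPowerSeries.rename (R := R) (fun _ : Unit => i) (MvPowerSeries.X ())) = _
  rw [MvPowerSeries.rename_X]

theorem isUnit_powerSeriesAt (i : Fin n)
    (y : Submonoid.powers (PowerSeries.X : PowerSeries R)) :
    IsUnit (powerSeriesAt i (y : PowerSeries R) : SpecRing R n) := by
  obtain ⟨_, m, rfl⟩ := y
  change IsUnit (powerSeriesAt i (PowerSeries.X ^ m))
  rw [map_pow, powerSeriesAt_X]
  exact (IsLocalization.map_units (SpecRing R n)
    ⟨MvPowerSeries.X i, MvPowerSeries.X_mem_nonzeroDivisors⟩).pow m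

/-- A Laurent series in `1/z`, read as a Laurent series in `1/z_i`: the substitution `z = z_i`. -/
def laurentAt (i : Fin n) : LaurentSeries R →+* SpecRing R n :=
  IsLocalization.lift (M := Submonoid.powers (PowerSeries.X : PowerSeries R))
    (isUnit_powerSeriesAt i)

/-- The element `z_i`. -/
def zVar (i : Fin n) : SpecRing R n := laurentAt i (HahnSeries.single (-1) 1)

theorem X_sub_mem_nonZeroDivisors {i j : Fin n} (hij : i ≠ j) (c : R) :
    (MvPowerSeries.X i - MvPowerSeries.C c * MvPowerSeries.X j : MvPowerSeries (Fin n) R) ∈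
      nonZeroDivisors (MvPowerSeries (Fin n) R) := by
  rw [mem_nonZeroDivisors_iff_right]
  intro f hf
  have key : ∀ (N : ℕ) (e : Fin n →₀ ℕ), e j ≤ N → MvPowerSeries.coeff e f = 0 := by
    intro N
    induction N with
    | zero =>
      intro e he
      have h := congrArg (MvPowerSeries.coeff (e + Finsupp.single i 1)) hf
      rw [mul_sub, ← mul_assoc, map_sub, MvPowerSeries.X_def, MvPowerSeries.X_def,
        MvPowerSeries.coeff_add_mul_monomial, MvPowerSeries.coeff_mul_monomial, if_neg] at h
      · simpa using h
      · intro hle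
        have := hle j
        simp [hij] at this
        omega
    | succ N ih =>
      intro e he
      have h := congrArg (MvPowerSeries.coeff (e + Finsupp.single i 1)) hf
      rw [mul_sub, ← mul_assoc, map_sub, MvPowerSeries.X_def, MvPowerSeries.X_def,
        MvPowerSeries.coeff_add_mul_monomial, MvPowerSeries.coeff_mul_monomial] at h
      split_ifs at h with hle
      · rw [mul_comm f, MvPowerSeries.coeff_C_mul,
          ih (e + Finsupp.single i 1 - Finsupp.single j 1)] at h
        · simpa using h
        · have := hle j
          simp [hij] at this ⊢
          omega
      · simpa using h
  ext e
  simpa using key _ e le_rfl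

theorem zVar_mul_X (i : Fin n) :
    (zVar i : SpecRing R n) * algebraMap (MvPowerSeries (Fin n) R) _ (MvPowerSeries.X i) = 1 := by
  have h : laurentAt i (HahnSeries.single 1 1 : LaurentSeries R) =
      algebraMap (MvPowerSeries (Fin n) R) (SpecRing R n) (MvPowerSeries.X i) := by
    rw [← powerSeriesAt_X, ← HahnSeries.ofPowerSeries_X (Γ := ℤ)]
    exact IsLocalization.lift_eq (isUnit_powerSeriesAt i) PowerSeries.X
  rw [← h, zVar, ← map_mul]
  simp [HahnSeries.single_mul_single]

/-- The denominators `z_i - c z_j` with `i ≠ j`, in particular with `c = ± 1`, are invertible. -/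
theorem isUnit_zVar_sub {i j : Fin n} (hij : i ≠ j) (c : R) :
    IsUnit (zVar i - algebraMap R (SpecRing R n) c * zVar j : SpecRing R n) := by
  set x := algebraMap (MvPowerSeries (Fin n) R) (SpecRing R n) with hx
  have hC : x (MvPowerSeries.C c) = algebraMap R (SpecRing R n) c := by
    rw [IsScalarTower.algebraMap_apply R (MvPowerSeries (Fin n) R) (SpecRing R n)]; rfl
  have h := IsLocalization.map_units (SpecRing R n)
    ⟨_, X_sub_mem_nonZeroDivisors (R := R) hij.symm c⟩
  rw [← hx] at h
  simp only [map_sub, map_mul, hC] at h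
  have hi := zVar_mul_X (R := R) i
  have hj := zVar_mul_X (R := R) j
  have hui : IsUnit (zVar i : SpecRing R n) := IsUnit.of_mul_eq_one _ hi
  have huj : IsUnit (zVar j : SpecRing R n) := IsUnit.of_mul_eq_one _ hj
  have e : (zVar i - algebraMap R (SpecRing R n) c * zVar j : SpecRing R n) =
      (x (MvPowerSeries.X j) - algebraMap R (SpecRing R n) c * x (MvPowerSeries.X i)) * zVar i *
        zVar j := by
    linear_combination (-(zVar i : SpecRing R n)) * hj +
      algebraMap R (SpecRing R n) c * (zVar j : SpecRing R n) * hi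
  rw [e]
  exact (h.mul hui).mul huj

/-- The denominators of the functions `D (z_i, z_j, t)` with `i ≠ j` are invertible. -/
theorem isUnit_zVar_sq_sub {i j : Fin n} (hij : i ≠ j) :
    IsUnit (zVar j ^ 2 - zVar i ^ 2 : SpecRing R n) := by
  have h := (isUnit_zVar_sub (R := R) hij.symm 1).mul (isUnit_zVar_sub (R := R) hij.symm (-1))
  have e : (zVar j ^ 2 - zVar i ^ 2 : SpecRing R n) =
      (zVar j - algebraMap R (SpecRing R n) 1 * zVar i) *
        (zVar j - algebraMap R (SpecRing R n) (-1) * zVar i) := by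
    simp only [map_one, map_neg]
    ring
  rw [e]
  exact h

variable (R n) in
/-- Finite sums of terms `c e^{m₁ θ(z₁) + ⋯ + mₙ θ(zₙ)}` with formal exponentials, `m ∈ ℤⁿ`; the
term `c e^{m₁ θ(z₁) + ⋯ + mₙ θ(zₙ)}` is `AddMonoidAlgebra.single m c`. -/
abbrev ExpRing : Type _ := AddMonoidAlgebra (SpecRing R n) (Fin n → ℤ)

/-- The element `a e^{ε θ(z)}` at `z = z_i`. -/
def waveAt (ε : ℤ) (i : Fin n) (a : LaurentSeries R) : ExpRing R n :=
  AddMonoidAlgebra.single (Pi.single i ε) (laurentAt i a)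

/-- The product of `D (σ i) (σ (i+1))` over `i` modulo `n`. -/
def cyclicProd {S : Type*} [CommRing S] (D : Fin n → Fin n → S) (σ : Equiv.Perm (Fin n)) : S :=
  ∏ i, D (σ i) (σ (finRotate n i))

theorem cyclicProd_mul_zpow {S : Type*} [CommRing S] (D : Fin n → Fin n → S)
    (σ : Equiv.Perm (Fin n)) (m : ℤ) : cyclicProd D (σ * finRotate n ^ m) = cyclicProd D σ := by
  unfold cyclicProd
  rw [← Equiv.prod_comp (finRotate n ^ m) fun i => D (σ i) (σ (finRotate n i))]
  refine Finset.prod_congr rfl fun i _ => ?_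
  have h : (finRotate n ^ m) (finRotate n i) = finRotate n ((finRotate n ^ m) i) := by
    rw [← Equiv.Perm.mul_apply, ← Equiv.Perm.mul_apply, (Commute.refl (finRotate n)).zpow_left m]
  simp only [Equiv.Perm.mul_apply, h]

variable (n) in
/-- The set `S_n / C_n` of cyclic orders of `n` elements. -/
abbrev CyclicOrders : Type := Equiv.Perm (Fin n) ⧸ Subgroup.zpowers (finRotate n)

/-- The sum of the cyclic products of `D` over all cyclic orders `σ ∈ S_n / C_n`. -/
def cyclicSum {S : Type*} [CommRing S] (D : Fin n → Fin n → S) : S :=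
  ∑ᶠ q : CyclicOrders n, Quotient.liftOn' q (cyclicProd D) (by
    intro σ τ h
    rw [QuotientGroup.leftRel_apply] at h
    obtain ⟨m, hm⟩ := Subgroup.mem_zpowers_iff.mp h
    have h2 : τ = σ * finRotate n ^ m := by rw [hm, mul_inv_cancel_left]
    rw [h2, cyclicProd_mul_zpow])

end Spectral

section NPoint

variable {W : Type*} [CommRing W] [Algebra ℚ W]

/-- `D(z_i, z_j, t) = (ψ(z_i) ψ*_x(z_j) - ψ*(z_j) ψ_x(z_i)) / (z_j² - z_i²)` for `i ≠ j`, where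
`ψ = a e^{θ(z)}` and `ψ* = b e^{-θ(z)}`. -/
def waveD {n : ℕ} (δ : Derivation ℚ W W) (a b : LaurentSeries (TimeSeries W)) (i j : Fin n) :
    ExpRing (TimeSeries W) n :=
  Ring.inverse (zVar j ^ 2 - zVar i ^ 2 : SpecRing (TimeSeries W) n) •
    (waveAt 1 i a * waveAt (-1) j (expDer δ (-1) 0 b)
      - waveAt (-1) j b * waveAt 1 i (expDer δ 1 0 a))

/-- The generating series
`∑_{p₁,…,pₙ ≥ 0} Ω_{p₁,…,pₙ}(t) ∏_j (2p_j+1)!! / z_j^{2p_j+2}` of the `n`-point correlation functions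
of `u`, as a power series in `1/z₁, …, 1/zₙ`. -/
def nPointSeries (δ : Derivation ℚ W W) (Ω : ℕ → ℕ → DiffPoly) (u : TimeSeries W) (n : ℕ) :
    MvPowerSeries (Fin n) (TimeSeries W) :=
  fun e => if ∀ j, Even (e j) ∧ 2 ≤ e j then
      evalAt δ u (multiOmega Ω (List.ofFn fun j => (e j - 2) / 2)) *
        ∏ j, (Nat.doubleFactorial (2 * ((e j - 2) / 2) + 1) : TimeSeries W)
    else 0

end NPoint

end KdV

end

/-! Collect the flows in the generating derivation ∇(z) = ∑_q (2q+1)!! z^{-2q-2} ∂/∂t_q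
(`vertexDer`). Applied to the generating series of the correlation functions, ∇(z) inserts one more
point (`vertexDer_corrSeries`). The theorem therefore follows by induction on n once n = 2 is known
and the cyclic sums obey the same insertion rule up to sign. Everything is expressed through the
resolvent series r(z) = ∑ β_m z^{-2m} of u.

Evolution of r. The KdV equations say ∇(w) u = ∂_x r(w). Applying ∇(w) to the resolvent equation
gives a linear equation for ∇(w) r(z) with only one solution, namely (r(z) r'(w) - r(w) r'(z)) / (z²
- w²) (`IsKdVFlow.vertexDer_resSeries`).

Wave functions. The equations L ψ = z² ψ, L ψ* = z² ψ* and the residue conditions force ψψ* to be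
even in z and the Wronskian ψψ*_x - ψ_xψ* to be -2z (`wave_products`). Then ψψ* solves the resolvent
equation, so ψψ* = r by uniqueness, and ψ_xψ* = (r' + 2z)/2, ψψ*_x = (r' - 2z)/2. Hence e(z,w) =
D(z,w) ψ(w)/ψ(z) is a rational expression in r, r' and the spectral variables (`gaugedKernel`), and
e has the same cyclic products as D.

Insertion. With e_ij = e(z_i, z_j) one finds ∇(z_n) e_ij = -e_in e_nj + (g_j - g_i) e_ij
(`ResolventSystem.insertion_gaugedKernel`). In the derivative of a cyclic product the terms with g
telescope to zero, and the others put n into each edge of the cycle, with sign -1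
(`derivation_cycleSum`).

Two points. The tau-structure axioms give ∂_x of the two-point series as ∇(z) r(w). An explicit
quadratic expression in r, r', r'' has the same x-derivative, and both sides vanish at u = 0. Since
∂ annihilates only constants among differential polynomials, they agree
(`IsCanonicalTauStructure.twoPoint`), and the resolvent equation turns the expression into -e_12
e_21 - 1/(z_1 - z_2)². -/

noncomputable section

namespace KdV

/-! ### Derivations of power series rings -/

section Derivations

variable {R : Type*} [CommRing R] [Algebra ℚ R] {σ : Type*}

/-- The derivation of a power series ring that applies `d` to all coefficients. -/
def coeffDer (σ : Type*) (d : Derivation ℚ R R) :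
    Derivation ℚ (MvPowerSeries σ R) (MvPowerSeries σ R) :=
  Derivation.mk'
    { toFun := fun f => (fun m => d (MvPowerSeries.coeff m f) : MvPowerSeries σ R)
      map_add' := by
        intro f g; ext m
        exact (congrArg d (map_add (MvPowerSeries.coeff m) f g)).trans (map_add d _ _)
      map_smul' := by
        intro c f; ext m
        exact d.map_smul c (MvPowerSeries.coeff m f) }
    (by
      classical
      intro f g; ext m
      change d (MvPowerSeries.coeff m (f * g)) = MvPowerSeries.coeff m (f * _ + g * _)
      rw [map_add, MvPowerSeries.coeff_mul, MvPowerSeries.coeff_mul, mul_comm g,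
        MvPowerSeries.coeff_mul, map_sum, ← Finset.sum_add_distrib]
      refine Finset.sum_congr rfl fun p _ => ?_
      rw [Derivation.leibniz, smul_eq_mul, smul_eq_mul,
        mul_comm (MvPowerSeries.coeff p.2 g)]
      rfl)

@[simp]
theorem coeff_coeffDer (d : Derivation ℚ R R) (f : MvPowerSeries σ R) (e : σ →₀ ℕ) :
    MvPowerSeries.coeff e (coeffDer σ d f) = d (MvPowerSeries.coeff e f) := rfl

@[simp]
theorem coeffDer_X (d : Derivation ℚ R R) (i : σ) :
    coeffDer σ d (MvPowerSeries.X i) = 0 := by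
  classical
  ext e
  rw [coeff_coeffDer, MvPowerSeries.coeff_X]
  split_ifs <;> simp

theorem coeffDer_X_pow_mul (d : Derivation ℚ R R) (i : σ) (k : ℕ) (f : MvPowerSeries σ R) :
    coeffDer σ d (MvPowerSeries.X i ^ k * f) = MvPowerSeries.X i ^ k * coeffDer σ d f := by
  rw [Derivation.leibniz, Derivation.leibniz_pow]
  simp

/-- The summand `(2q+1)!! X_i^(2q+2) d_q` of the derivation `vertexDer`. -/
def vertexTerm (d : ℕ → Derivation ℚ R R) (i : σ) (q : ℕ) :
    Derivation ℚ (MvPowerSeries σ R) (MvPowerSeries σ R) :=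
  (MvPowerSeries.monomial (R := R) (Finsupp.single i (2 * q + 2))
    ((Nat.doubleFactorial (2 * q + 1) : ℕ) : R)) • coeffDer σ (d q)

theorem coeff_vertexTerm (d : ℕ → Derivation ℚ R R) (i : σ) (q : ℕ) (f : MvPowerSeries σ R)
    (e : σ →₀ ℕ) :
    MvPowerSeries.coeff e (vertexTerm d i q f) = if 2 * q + 2 ≤ e i then
      (Nat.doubleFactorial (2 * q + 1) : ℕ) *
        d q (MvPowerSeries.coeff (e - Finsupp.single i (2 * q + 2)) f) else 0 := by
  classical
  simp only [vertexTerm, Derivation.smul_apply, smul_eq_mul]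
  rw [MvPowerSeries.coeff_monomial_mul]
  simp only [Finsupp.single_le_iff, coeff_coeffDer]

/-- The coefficients of `∑_q (2q+1)!! X_i^(2q+2) d_q f`. -/
def vertexFun (d : ℕ → Derivation ℚ R R) (i : σ) (f : MvPowerSeries σ R) : MvPowerSeries σ R :=
  fun e => MvPowerSeries.coeff e (∑ q ∈ range (e i), vertexTerm d i q f)

/-- Terms with `2 * q + 2 > e i` do not reach the exponent `e`, so every cutoff `N ≥ e i` gives the
same coefficient. Thus the infinite sum inherits linearity and the Leibniz rule from its finite
partial sums. -/
theorem coeff_vertexFun (d : ℕ → Derivation ℚ R R) (i : σ) (f : MvPowerSeries σ R)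
    (e : σ →₀ ℕ) {N : ℕ} (hN : e i ≤ N) :
    MvPowerSeries.coeff e (vertexFun d i f) =
      MvPowerSeries.coeff e ((∑ q ∈ range N, vertexTerm d i q) f) := by
  change MvPowerSeries.coeff e (∑ q ∈ range (e i), vertexTerm d i q f) = _
  have h : (∑ q ∈ range N, vertexTerm d i q) f = ∑ q ∈ range N, vertexTerm d i q f := by
    rw [← Derivation.coeFnAddMonoidHom_apply, map_sum, Finset.sum_apply]
    rfl
  rw [h, map_sum, map_sum]
  refine Finset.sum_subset (Finset.range_subset_range.2 hN) fun q _ hq => ?_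
  rw [Finset.mem_range] at hq
  rw [coeff_vertexTerm, if_neg (by omega)]

/-- The derivation `∑_q (2q+1)!! X_i^(2q+2) d_q` of a power series ring, where `d_q` acts on the
coefficients. -/
def vertexDer (d : ℕ → Derivation ℚ R R) (i : σ) :
    Derivation ℚ (MvPowerSeries σ R) (MvPowerSeries σ R) :=
  Derivation.mk'
    { toFun := vertexFun d i
      map_add' := by
        intro f g; ext e
        rw [map_add, coeff_vertexFun d i _ e le_rfl, coeff_vertexFun d i _ e le_rfl,
          coeff_vertexFun d i _ e le_rfl, map_add, map_add]
      map_smul' := by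
        intro c f; ext e
        rw [RingHom.id_apply, coeff_vertexFun d i _ e le_rfl, Derivation.map_smul]
        change c • MvPowerSeries.coeff e ((∑ q ∈ range (e i), vertexTerm d i q) f) =
          c • MvPowerSeries.coeff e (vertexFun d i f)
        rw [coeff_vertexFun d i _ e le_rfl] }
    (by
      classical
      intro f g; ext e
      change MvPowerSeries.coeff e (vertexFun d i (f * g)) =
        MvPowerSeries.coeff e (f * vertexFun d i g + g * vertexFun d i f)
      -- The coefficient of a product at `e` involves only exponents below `e`, so the single cutoff
      -- `e i` serves all of them.
      have key : ∀ f g : MvPowerSeries σ R, MvPowerSeries.coeff e (f * vertexFun d i g) =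
          MvPowerSeries.coeff e (f * (∑ q ∈ range (e i), vertexTerm d i q) g) := by
        intro f g
        rw [MvPowerSeries.coeff_mul, MvPowerSeries.coeff_mul]
        refine Finset.sum_congr rfl fun p hp => ?_
        rw [coeff_vertexFun d i g p.2 (N := e i)]
        rw [← Finset.HasAntidiagonal.mem_antidiagonal.1 hp]
        simp
      rw [map_add, key, key, coeff_vertexFun d i _ e le_rfl, Derivation.leibniz, map_add]
      rfl)

theorem coeff_vertexDer (d : ℕ → Derivation ℚ R R) (i : σ) (f : MvPowerSeries σ R)
    (e : σ →₀ ℕ) :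
    MvPowerSeries.coeff e (vertexDer d i f) = ∑ q ∈ range (e i), if 2 * q + 2 ≤ e i then
      ((Nat.doubleFactorial (2 * q + 1) : ℕ) : R) *
        d q (MvPowerSeries.coeff (e - Finsupp.single i (2 * q + 2)) f) else 0 := by
  change MvPowerSeries.coeff e (∑ q ∈ range (e i), vertexTerm d i q f) = _
  rw [map_sum]
  simp only [coeff_vertexTerm]

theorem vertexDer_coeffDer {d : ℕ → Derivation ℚ R R} {d' : Derivation ℚ R R}
    (h : ∀ q f, d q (d' f) = d' (d q f)) (i : σ) (f : MvPowerSeries σ R) :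
    vertexDer d i (coeffDer σ d' f) = coeffDer σ d' (vertexDer d i f) := by
  ext e
  rw [coeff_coeffDer, coeff_vertexDer, coeff_vertexDer, map_sum]
  refine Finset.sum_congr rfl fun q _ => ?_
  split_ifs with hq
  · simp [h]
  · simp

@[simp]
theorem vertexDer_X (d : ℕ → Derivation ℚ R R) (i j : σ) :
    vertexDer d i (MvPowerSeries.X j : MvPowerSeries σ R) = 0 := by
  classical
  ext e
  rw [coeff_vertexDer]
  refine Finset.sum_eq_zero fun q _ => ?_
  rw [MvPowerSeries.coeff_X]
  split_ifs <;> simp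

/-- A linear equation of the form `v F = X_i^2 (α F'' + β F' + γ F)` with a unit `v` only has the
solution `F = 0`. -/
theorem eq_zero_of_unit_mul_eq (d : Derivation ℚ R R) (i : σ) {v α β γ F : MvPowerSeries σ R}
    (hv : IsUnit v) (h : v * F = MvPowerSeries.X i ^ 2 *
      (α * coeffDer σ d (coeffDer σ d F) + β * coeffDer σ d F + γ * F)) : F = 0 := by
  obtain ⟨w, hw⟩ := hv.exists_left_inv
  -- `coeffDer` commutes with `X i`, so if `X i ^ k` divides `F`, it divides the bracket on the
  -- right. The factor `X i ^ 2` then raises the divisibility of `F`, which is therefore infinite.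
  have key : ∀ k, MvPowerSeries.X i ^ k ∣ F := by
    intro k
    induction k with
    | zero => simp
    | succ k ih =>
      obtain ⟨G, hG⟩ := ih
      refine ⟨w * MvPowerSeries.X i *
        (α * coeffDer σ d (coeffDer σ d G) + β * coeffDer σ d G + γ * G), ?_⟩
      have h1 : coeffDer σ d F = MvPowerSeries.X i ^ k * coeffDer σ d G := by
        rw [hG, coeffDer_X_pow_mul]
      have h2 : coeffDer σ d (coeffDer σ d F) =
          MvPowerSeries.X i ^ k * coeffDer σ d (coeffDer σ d G) := by
        rw [h1, coeffDer_X_pow_mul]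
      rw [h2, h1] at h
      linear_combination (-F) * hw + w * h + w * MvPowerSeries.X i ^ 2 * γ * hG
  ext e
  exact MvPowerSeries.X_pow_dvd_iff.1 (key (e i + 1)) e (Nat.lt_succ_self _)

end Derivations

/-! ### Extension of derivations to rings of fractions -/

section Localization

/-- A derivation extends to a localization. -/
theorem exists_derivation_localization {K P S : Type*} [CommRing K] [CommRing P] [Algebra K P]
    [CommRing S] [Algebra P S] (M : Submonoid P) [IsLocalization M S] (D : Derivation K P P) :
    ∃ D' : Derivation ℤ S S, ∀ f, D' (algebraMap P S f) = algebraMap P S (D f) := by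
  -- A derivation is the same as a ring map f ↦ f + ε D f into the dual numbers. An element there is
  -- a unit as soon as its first component is, so the map extends by the universal property of
  -- localization.
  let φ : P →+* TrivSqZeroExt S S :=
    { toFun := fun f =>
        TrivSqZeroExt.inl (algebraMap P S f) + TrivSqZeroExt.inr (algebraMap P S (D f))
      map_one' := by ext <;> simp
      map_zero' := by ext <;> simp
      map_add' := by intro f g; ext <;> simp [Algebra.smul_def]
      map_mul' := by
        intro f g
        ext
        · simp
        · simp only [TrivSqZeroExt.snd_add, TrivSqZeroExt.snd_mul, TrivSqZeroExt.fst_add,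
            TrivSqZeroExt.fst_inl, TrivSqZeroExt.fst_inr, TrivSqZeroExt.snd_inl,
            TrivSqZeroExt.snd_inr, map_mul, map_add, Derivation.leibniz, smul_eq_mul,
            MulOpposite.smul_eq_mul_unop, MulOpposite.unop_op]
          ring }
  have hφ : ∀ m : M, IsUnit (φ m) := fun m => by
    rw [TrivSqZeroExt.isUnit_iff_isUnit_fst]
    simpa [φ] using IsLocalization.map_units S m
  let Φ : S →+* TrivSqZeroExt S S := IsLocalization.lift hφ
  have hΦ : ∀ f, Φ (algebraMap P S f) = φ f := fun f => IsLocalization.lift_eq hφ f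
  have hfst : ∀ s, (Φ s).fst = s := by
    have : ((TrivSqZeroExt.fstHom S S S).toRingHom.comp Φ) = RingHom.id S := by
      apply IsLocalization.ringHom_ext M
      ext f
      change (Φ (algebraMap P S f)).fst = algebraMap P S f
      rw [hΦ]; simp [φ]
    intro s
    exact congrArg (fun g : S →+* S => g s) this
  refine ⟨Derivation.mk' (AddMonoidHom.toIntLinearMap
    { toFun := fun s => (Φ s).snd
      map_zero' := by simp
      map_add' := by intro s t; simp }) ?_, ?_⟩
  · intro s t
    change (Φ (s * t)).snd = s * (Φ t).snd + t * (Φ s).snd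
    rw [map_mul, TrivSqZeroExt.snd_mul, hfst, hfst]
    simp [mul_comm]
  · intro f
    change (Φ (algebraMap P S f)).snd = _
    rw [hΦ]
    simp only [φ, RingHom.coe_mk, MonoidHom.coe_mk, OneHom.coe_mk, TrivSqZeroExt.snd_add,
      TrivSqZeroExt.snd_inl, TrivSqZeroExt.snd_inr, zero_add]

end Localization

/-! ### The resolvent equation -/

section Resolvent

variable {A B : Type*} [CommRing A] [Algebra ℚ A] [CommRing B] [Algebra ℚ B]

/-- The equation `b b'' - b'^2 / 2 - 2 (λ - 2 u) b^2 = -2 λ`, multiplied by `2 t`, where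
`t = 1 / λ`. -/
def ResolventEq (D : Derivation ℚ A A) (t u b : A) : Prop :=
  t * (2 * (b * D (D b)) - D b ^ 2 + 8 * u * b ^ 2) - 4 * b ^ 2 = -4

theorem ResolventEq.map {D : Derivation ℚ A A} {t u b : A} (h : ResolventEq D t u b)
    (φ : A →+* B) {D' : Derivation ℚ B B} (hφ : ∀ f, φ (D f) = D' (φ f)) :
    ResolventEq D' (φ t) (φ u) (φ b) := by
  have h1 := congrArg φ h
  simp only [map_sub, map_mul, map_add, map_pow, map_neg, map_ofNat, hφ] at h1
  exact h1

theorem isUnit_two : IsUnit (2 : A) := by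
  have h := (IsUnit.mk0 (2 : ℚ) two_ne_zero).map (algebraMap ℚ A)
  rwa [map_ofNat] at h

/-- The derivative of the resolvent equation is `2 * b` times this linear third-order equation. -/
theorem ResolventEq.third {D : Derivation ℚ A A} {t u b : A} (h : ResolventEq D t u b)
    (hb : IsUnit b) (ht : D t = 0) :
    t * (D (D (D b)) + 4 * D u * b + 8 * u * D b) = 4 * D b := by
  have h1 := congrArg D h
  have h2 : D 2 = 0 := by simpa using D.map_natCast 2
  have h4 : D 4 = 0 := by simpa using D.map_natCast 4
  have h8 : D 8 = 0 := by simpa using D.map_natCast 8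
  simp only [map_sub, map_add, map_neg, Derivation.leibniz, Derivation.leibniz_pow, smul_eq_mul,
    nsmul_eq_mul, ht, h2, h4, h8] at h1
  apply (isUnit_two.mul hb).mul_left_cancel
  push_cast at h1
  linear_combination h1

/-- First variation of the resolvent equation along a derivation commuting with `D`, divided by `2`.
The term with `E u` is the inhomogeneity. -/
theorem ResolventEq.linearize {D E : Derivation ℚ A A} {t u b : A} (h : ResolventEq D t u b)
    (ht : E t = 0) (hDE : ∀ f, E (D f) = D (E f)) :
    t * (D (D b) * E b + b * D (D (E b)) - D b * D (E b) + 8 * u * b * E b + 4 * E u * b ^ 2) =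
      4 * b * E b := by
  have h1 := congrArg E h
  have h2 : E 2 = 0 := by simpa using E.map_natCast 2
  have h4 : E 4 = 0 := by simpa using E.map_natCast 4
  have h8 : E 8 = 0 := by simpa using E.map_natCast 8
  simp only [map_sub, map_add, map_neg, Derivation.leibniz, Derivation.leibniz_pow, smul_eq_mul,
    nsmul_eq_mul, ht, h2, h4, h8, hDE] at h1
  apply isUnit_two.mul_left_cancel
  push_cast at h1
  linear_combination h1

end Resolvent

/-! ### Uniqueness of the resolvent and its evolution along the flows -/

section Flow

variable {R : Type*} [CommRing R] [Algebra ℚ R] {σ : Type*}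

/-- Solutions with constant term `1` of the resolvent equation are unique. -/
theorem ResolventEq.unique {d : Derivation ℚ R R} {i : σ} {u : MvPowerSeries σ R}
    {F G : MvPowerSeries σ R} (hF : ResolventEq (coeffDer σ d) (MvPowerSeries.X i ^ 2) u F)
    (hG : ResolventEq (coeffDer σ d) (MvPowerSeries.X i ^ 2) u G)
    (hF1 : MvPowerSeries.constantCoeff F = 1) (hG1 : MvPowerSeries.constantCoeff G = 1) :
    F = G := by
  rw [← sub_eq_zero]
  unfold ResolventEq at hF hG
  -- The difference of the two quadratic equations is linear in `F - G`. The part without `X i ^ 2`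
  -- is `4 * (F + G) * (F - G)`, and `4 * (F + G)` has constant term `8`.
  refine eq_zero_of_unit_mul_eq d i (v := 4 * (F + G)) (α := 2 * G)
    (β := - (coeffDer σ d F + coeffDer σ d G))
    (γ := 2 * coeffDer σ d (coeffDer σ d F) + 8 * u * (F + G)) ?_ ?_
  · rw [MvPowerSeries.isUnit_iff_constantCoeff]
    simp only [map_mul, map_add, hF1, hG1, map_ofNat]
    have h2 := isUnit_two (A := R)
    convert h2.pow 3 using 1
    norm_num
  · simp only [map_sub]
    linear_combination hG - hF

/-- A power series in `1 / λ`, read as a power series in `X_j = 1 / z_j`, where `λ = z_j^2`. -/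
def varSeries (j : σ) [Filter.TendstoCofinite (fun _ : Unit => j)] :
    PowerSeries R →ₐ[R] MvPowerSeries σ R :=
  (MvPowerSeries.rename (R := R) (fun _ : Unit => j)).comp (PowerSeries.expand 2 two_ne_zero)

theorem coeff_rename_unit [DecidableEq σ] (j : σ) (P : PowerSeries R) (e : σ →₀ ℕ) :
    MvPowerSeries.coeff e (MvPowerSeries.rename (R := R) (fun _ : Unit => j) P) =
      if e = Finsupp.single j (e j) then PowerSeries.coeff (e j) P else 0 := by
  split_ifs with h
  · have h1 := MvPowerSeries.coeff_embDomain_rename (R := R)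
      (⟨fun _ : Unit => j, fun _ _ _ => rfl⟩ : Unit ↪ σ) P (Finsupp.single () (e j))
    rw [Finsupp.embDomain_single] at h1
    rw [h, Finsupp.single_eq_same]
    exact h1
  · apply MvPowerSeries.coeff_rename_eq_zero
    rintro ⟨x, rfl⟩
    apply h
    have hx : x = Finsupp.single () (x ()) := by ext; simp
    rw [hx, Finsupp.mapDomain_single]
    simp

theorem coeff_varSeries [DecidableEq σ] (j : σ) (P : PowerSeries R) (e : σ →₀ ℕ) :
    MvPowerSeries.coeff e (varSeries j P) =
      if e = Finsupp.single j (e j) ∧ 2 ∣ e j then PowerSeries.coeff (e j / 2) P else 0 := by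
  change MvPowerSeries.coeff e (MvPowerSeries.rename (R := R) (fun _ : Unit => j)
    (PowerSeries.expand 2 two_ne_zero P)) = _
  rw [coeff_rename_unit, PowerSeries.coeff_expand]
  rw [ite_and]

theorem coeffDer_rename (d : Derivation ℚ R R) (j : σ) (P : PowerSeries R) :
    MvPowerSeries.rename (R := R) (fun _ : Unit => j) (coeffDer Unit d P) =
      coeffDer σ d (MvPowerSeries.rename (R := R) (fun _ : Unit => j) P) := by
  classical
  ext e
  rw [coeff_coeffDer, coeff_rename_unit, coeff_rename_unit]
  split_ifs
  · rfl
  · simp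

theorem coeffDer_expand (d : Derivation ℚ R R) (P : PowerSeries R) :
    PowerSeries.expand 2 two_ne_zero (coeffDer Unit d P : PowerSeries R) =
      coeffDer Unit d (PowerSeries.expand 2 two_ne_zero P) := by
  ext m
  change _ = d (PowerSeries.coeff m (PowerSeries.expand 2 two_ne_zero P))
  rw [PowerSeries.coeff_expand, PowerSeries.coeff_expand]
  split_ifs
  · rfl
  · simp

theorem coeffDer_varSeries (d : Derivation ℚ R R) (j : σ) (P : PowerSeries R) :
    varSeries j (coeffDer Unit d P : PowerSeries R) = coeffDer σ d (varSeries j P) := by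
  change MvPowerSeries.rename (R := R) (fun _ : Unit => j)
    (PowerSeries.expand 2 two_ne_zero (coeffDer Unit d P : PowerSeries R)) = _
  rw [coeffDer_expand, coeffDer_rename]
  rfl

/-- Derivations `d_q` (with `d_0 = ∂_x`), an element `u` and the coefficients `β_m` of a solution
of the resolvent equation, such that the `d_q` commute with `∂_x` and `u` evolves along `d_q` by the
KdV hierarchy. -/
structure IsKdVFlow (d : ℕ → Derivation ℚ R R) (u : R) (β : ℕ → R) : Prop where
  zero : β 0 = 1
  resolvent : ResolventEq (A := PowerSeries R) (coeffDer Unit (d 0)) PowerSeries.X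
    (PowerSeries.C u) (PowerSeries.mk β)
  comm : ∀ q f, d q (d 0 f) = d 0 (d q f)
  flow : ∀ q, ((Nat.doubleFactorial (2 * q + 1) : ℕ) : R) * d q u = d 0 (β (q + 1))

/-- The resolvent series `∑_m β_m / z_j^(2m)`. -/
def resSeries (β : ℕ → R) (j : σ) : MvPowerSeries σ R := varSeries j (PowerSeries.mk β)

variable {d : ℕ → Derivation ℚ R R} {u : R} {β : ℕ → R}

theorem IsKdVFlow.resolventEq (h : IsKdVFlow d u β) (j : σ) :
    ResolventEq (coeffDer σ (d 0)) (MvPowerSeries.X j ^ 2) (MvPowerSeries.C u)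
      (resSeries β j) := by
  have h1 := h.resolvent.map (varSeries (σ := σ) j).toRingHom
    (D' := coeffDer σ (d 0)) (coeffDer_varSeries (d 0) j)
  have hX : varSeries (σ := σ) j (PowerSeries.X : PowerSeries R) = MvPowerSeries.X j ^ 2 := by
    change MvPowerSeries.rename (R := R) (fun _ : Unit => j)
      (PowerSeries.expand 2 two_ne_zero PowerSeries.X) = _
    rw [PowerSeries.expand_X, map_pow]
    congr 1
    exact MvPowerSeries.rename_X _ _
  have hC : varSeries (σ := σ) j (PowerSeries.C u : PowerSeries R) = MvPowerSeries.C u := by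
    change MvPowerSeries.rename (R := R) (fun _ : Unit => j)
      (PowerSeries.expand 2 two_ne_zero (PowerSeries.C u)) = _
    rw [PowerSeries.expand_C]
    exact MvPowerSeries.rename_C _ _
  simp only [AlgHom.toRingHom_eq_coe, RingHom.coe_coe, hX, hC] at h1
  exact h1

theorem IsKdVFlow.constantCoeff_resSeries (h : IsKdVFlow d u β) (j : σ) :
    MvPowerSeries.constantCoeff (resSeries β j) = 1 := by
  classical
  rw [← MvPowerSeries.coeff_zero_eq_constantCoeff_apply, resSeries, coeff_varSeries]
  simp [h.zero]

theorem IsKdVFlow.isUnit_resSeries (h : IsKdVFlow d u β) (j : σ) :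
    IsUnit (resSeries β j) := by
  rw [MvPowerSeries.isUnit_iff_constantCoeff, h.constantCoeff_resSeries]
  exact isUnit_one

/-- All KdV equations at once. The index shift in `flow` matches the exponent `2 * q + 2`, and the
extra term `β 0 = 1` of the resolvent has zero derivative. -/
theorem IsKdVFlow.vertexDer_C (h : IsKdVFlow d u β) (i : σ) :
    vertexDer d i (MvPowerSeries.C u) = coeffDer σ (d 0) (resSeries β i) := by
  classical
  ext e
  rw [coeff_vertexDer, coeff_coeffDer, resSeries, coeff_varSeries]
  by_cases he : e = Finsupp.single i (e i) ∧ 2 ∣ e i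
  · rw [if_pos he]
    obtain ⟨h1, m, hm⟩ := he
    cases m with
    | zero => simp [hm, h.zero]
    | succ m =>
      rw [Finset.sum_eq_single m]
      · rw [if_pos (by omega), hm, show 2 * (m + 1) / 2 = m + 1 by omega, PowerSeries.coeff_mk,
          ← h.flow]
        have : e - Finsupp.single i (2 * m + 2) = 0 := by
          rw [h1, hm, ← Finsupp.single_tsub]
          simp [mul_add]
        rw [this]
        simp
      · intro q _ hq
        split_ifs with hle
        · rw [MvPowerSeries.coeff_C, if_neg]
          · simp
          · intro h0
            have := DFunLike.congr_fun h0 i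
            simp at this
            omega
        · rfl
      · intro hm'
        exact absurd (Finset.mem_range.2 (by omega)) hm'
  · rw [if_neg he, map_zero]
    refine Finset.sum_eq_zero fun q _ => ?_
    split_ifs with hle
    · rw [MvPowerSeries.coeff_C, if_neg]
      · simp
      · intro h0
        apply he
        have h1 : e = Finsupp.single i (2 * q + 2) := by
          rw [← tsub_add_cancel_of_le (Finsupp.single_le_iff.2 hle), h0, zero_add]
        rw [h1]
        simp
    · rfl

/-- The action of the generating derivation `∑_q (2q+1)!! X_i^(2q+2) d_q` on the resolvent
series. -/
theorem IsKdVFlow.vertexDer_resSeries (h : IsKdVFlow d u β) (i j : σ) :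
    (MvPowerSeries.X i ^ 2 - MvPowerSeries.X j ^ 2) * vertexDer d i (resSeries β j) =
      MvPowerSeries.X i ^ 2 * MvPowerSeries.X j ^ 2 *
        (resSeries β j * coeffDer σ (d 0) (resSeries β i)
          - resSeries β i * coeffDer σ (d 0) (resSeries β j)) := by
  have hXi : coeffDer σ (d 0) (MvPowerSeries.X i ^ 2) = 0 := by simp [Derivation.leibniz_pow]
  have hXj : coeffDer σ (d 0) (MvPowerSeries.X j ^ 2) = 0 := by simp [Derivation.leibniz_pow]
  have hVj : vertexDer d i (MvPowerSeries.X j ^ 2) = 0 := by simp [Derivation.leibniz_pow]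
  have hi := h.resolventEq i
  have hj := h.resolventEq j
  have ti := hi.third (h.isUnit_resSeries i) hXi
  have tj := hj.third (h.isUnit_resSeries j) hXj
  have lj := hj.linearize hVj (vertexDer_coeffDer h.comm i)
  rw [h.vertexDer_C i] at lj
  unfold ResolventEq at hi hj
  -- The difference of the two sides solves the homogeneous linearized equation at `j`: the
  -- third-order equations of both resolvent series account for the inhomogeneity. The factor `X j ^
  -- 2` in front of the derivatives then makes it zero.
  rw [← sub_eq_zero]
  refine eq_zero_of_unit_mul_eq (d 0) j (v := 4 * resSeries β j) (α := resSeries β j)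
    (β := - coeffDer σ (d 0) (resSeries β j))
    (γ := coeffDer σ (d 0) (coeffDer σ (d 0) (resSeries β j))
      + 8 * MvPowerSeries.C u * resSeries β j) ?_ ?_
  · refine IsUnit.mul ?_ (h.isUnit_resSeries j)
    have h2 := isUnit_two (A := MvPowerSeries σ R)
    convert h2.pow 2 using 1
    norm_num
  · have h1 : coeffDer σ (d 0) (MvPowerSeries.X i) = 0 := coeffDer_X _ _
    have h2 : coeffDer σ (d 0) (MvPowerSeries.X j) = 0 := coeffDer_X _ _
    simp only [map_sub, map_add, Derivation.leibniz, Derivation.leibniz_pow, smul_eq_mul,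
      nsmul_eq_mul, h1, h2, mul_zero, add_zero, map_zero]
    set D := coeffDer σ (d 0)
    set r := resSeries β j
    set s := resSeries β i
    set X := MvPowerSeries.X (R := R) i
    set Y := MvPowerSeries.X (R := R) j
    linear_combination (-(X ^ 2 - Y ^ 2)) * lj + Y ^ 4 * r ^ 2 * ti - X ^ 2 * Y ^ 2 * r * s * tj

end Flow

/-! ### Generating series of correlation functions -/

section Correlators

variable {R : Type*} [CommRing R] [Algebra ℚ R] {σ : Type*}

open Classical in
/-- The series `∑ om(p₁, …, p_k) ∏_j (2p_j+1)!! X_j^(2p_j+2)` in the variables of the list `l`. -/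
def corrSeries (om : List ℕ → R) (l : List σ) : MvPowerSeries σ R := fun e =>
  if (∀ j ∈ l, Even (e j) ∧ 2 ≤ e j) ∧ ∀ j ∉ l, e j = 0 then
    om (l.map fun j => (e j - 2) / 2) *
      (l.map fun j => ((Nat.doubleFactorial (2 * ((e j - 2) / 2) + 1) : ℕ) : R)).prod
  else 0

open Classical in
theorem coeff_corrSeries (om : List ℕ → R) (l : List σ) (e : σ →₀ ℕ) :
    MvPowerSeries.coeff e (corrSeries om l) =
      if (∀ j ∈ l, Even (e j) ∧ 2 ≤ e j) ∧ ∀ j ∉ l, e j = 0 then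
        om (l.map fun j => (e j - 2) / 2) *
          (l.map fun j => ((Nat.doubleFactorial (2 * ((e j - 2) / 2) + 1) : ℕ) : R)).prod
      else 0 := rfl

theorem map_corrSeries {R' : Type*} [CommRing R'] [Algebra ℚ R'] (φ : R →+* R')
    (om : List ℕ → R) (l : List σ) :
    MvPowerSeries.map φ (corrSeries om l) = corrSeries (fun p => φ (om p)) l := by
  classical
  ext e
  rw [MvPowerSeries.coeff_map, coeff_corrSeries, coeff_corrSeries]
  split_ifs
  · simp [map_list_prod, Function.comp_def]
  · simp

theorem prod_natCast_map (l : List σ) (f : σ → ℕ) :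
    (l.map fun j => ((f j : ℕ) : R)).prod = (((l.map f).prod : ℕ) : R) := by
  induction l with
  | nil => simp
  | cons a l ih => simp [ih]

theorem derivation_mul_natCast (d : Derivation ℚ R R) (f : R) (n : ℕ) :
    d (f * n) = d f * n := by
  rw [Derivation.leibniz, Derivation.map_natCast]
  simp [mul_comm]

theorem coeffDer_corrSeries (d : Derivation ℚ R R) (om : List ℕ → R) (l : List σ) :
    coeffDer σ d (corrSeries om l) = corrSeries (fun p => d (om p)) l := by
  classical
  ext e
  rw [coeff_coeffDer, coeff_corrSeries, coeff_corrSeries]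
  split_ifs
  · rw [prod_natCast_map, derivation_mul_natCast]
  · simp

/-- The generating derivation inserts one more point. -/
theorem vertexDer_corrSeries (d : ℕ → Derivation ℚ R R) (om : List ℕ → R) {i : σ} {l : List σ}
    (hi : i ∉ l) (hom : ∀ p ps, ps.length = l.length → om (p :: ps) = d p (om ps)) :
    vertexDer d i (corrSeries om l) = corrSeries om (i :: l) := by
  classical
  ext e
  rw [coeff_vertexDer, coeff_corrSeries]
  have hne : ∀ j ∈ l, j ≠ i := fun j hj h => hi (h ▸ hj)
  have hsub : ∀ (q : ℕ) (j : σ), j ≠ i → (e - Finsupp.single i (2 * q + 2)) j = e j := by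
    intro q j hj
    rw [Finsupp.tsub_apply, Finsupp.single_eq_of_ne hj, Nat.sub_zero]
  have hsubi : ∀ q : ℕ, (e - Finsupp.single i (2 * q + 2)) i = e i - (2 * q + 2) := by
    intro q
    rw [Finsupp.tsub_apply, Finsupp.single_eq_same]
  split_ifs with h
  · obtain ⟨h1, h2⟩ := h
    obtain ⟨⟨m, hm⟩, hm2⟩ := h1 i (by simp)
    obtain ⟨m, rfl⟩ : ∃ k, m = k + 1 := ⟨m - 1, by omega⟩
    -- Since `i ∉ l`, the series for `l` does not contain the variable of `i`; only the `q` with `2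
    -- * q + 2 = e i` survives.
    rw [Finset.sum_eq_single m]
    · have hcond : (∀ j ∈ l, Even ((e - Finsupp.single i (2 * m + 2)) j) ∧
          2 ≤ (e - Finsupp.single i (2 * m + 2)) j) ∧
          ∀ j ∉ l, (e - Finsupp.single i (2 * m + 2)) j = 0 := by
        refine ⟨fun j hj => ?_, fun j hj => ?_⟩
        · rw [hsub m j (hne j hj)]
          exact h1 j (List.mem_cons_of_mem _ hj)
        · by_cases hji : j = i
          · subst hji
            rw [hsubi]
            omega
          · rw [hsub m j hji]
            exact h2 j (by simp [hji, hj])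
      rw [if_pos (by omega), coeff_corrSeries, if_pos hcond, prod_natCast_map,
        derivation_mul_natCast, ← hom _ _ (by simp), ← prod_natCast_map]
      have e1 : ((e i - 2) / 2) = m := by omega
      have e2 : (l.map fun j => ((e - Finsupp.single i (2 * m + 2)) j - 2) / 2) =
          l.map fun j => (e j - 2) / 2 :=
        List.map_congr_left fun j hj => by rw [hsub m j (hne j hj)]
      have e3 : (l.map fun j => ((Nat.doubleFactorial
            (2 * (((e - Finsupp.single i (2 * m + 2)) j - 2) / 2) + 1) : ℕ) : R)) =
          l.map fun j => ((Nat.doubleFactorial (2 * ((e j - 2) / 2) + 1) : ℕ) : R) :=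
        List.map_congr_left fun j hj => by rw [hsub m j (hne j hj)]
      rw [e2, e3, List.map_cons, List.map_cons, List.prod_cons, e1]
      ring
    · intro q _ hq
      split_ifs with hle
      · rw [coeff_corrSeries, if_neg, map_zero, mul_zero]
        rintro ⟨-, h3⟩
        have := h3 i hi
        rw [hsubi] at this
        omega
      · rfl
    · intro hm'
      exact absurd (Finset.mem_range.2 (by omega)) hm'
  · refine Finset.sum_eq_zero fun q _ => ?_
    split_ifs with hle
    · rw [coeff_corrSeries, if_neg, map_zero, mul_zero]
      rintro ⟨h3, h4⟩
      apply h
      have h5 := h4 i hi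
      rw [hsubi] at h5
      refine ⟨fun j hj => ?_, fun j hj => ?_⟩
      · rcases List.mem_cons.1 hj with rfl | hj
        · exact ⟨⟨q + 1, by omega⟩, by omega⟩
        · have := h3 j hj
          rwa [hsub q j (hne j hj)] at this
      · rw [List.mem_cons, not_or] at hj
        have := h4 j hj.2
        rwa [hsub q j hj.1] at this
    · rfl

theorem multiOmega_cons (Ω : ℕ → ℕ → DiffPoly) (p : ℕ) {ps : List ℕ} (h : 2 ≤ ps.length) :
    multiOmega Ω (p :: ps) = kdvDer p (multiOmega Ω ps) := by
  match ps, h with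
  | q :: r :: l, _ => rw [multiOmega]

end Correlators

/-! ### The KdV flows on differential polynomials -/

section DiffPolys

theorem dPoly_uVar (i : ℕ) : dPoly (uVar i) = uVar (i + 1) :=
  MvPolynomial.mkDerivation_X _ _ _

theorem constantCoeff_derivation (D : Derivation ℚ DiffPoly DiffPoly)
    (hD : ∀ i, MvPolynomial.constantCoeff (D (uVar i)) = 0) (p : DiffPoly) :
    MvPolynomial.constantCoeff (D p) = 0 := by
  induction p using MvPolynomial.induction_on with
  | C a => rw [← MvPolynomial.algebraMap_eq, Derivation.map_algebraMap, map_zero]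
  | add p q hp hq => simp [hp, hq]
  | mul_X p i hp => simp [Derivation.leibniz, hD, hp]

theorem constantCoeff_dPoly (p : DiffPoly) : MvPolynomial.constantCoeff (dPoly p) = 0 :=
  constantCoeff_derivation _ (fun i => by rw [dPoly_uVar]; simp) p

/-- The commutator of `∂/∂u_{n+1}` with `∂` is `∂/∂u_n`, as is seen on the variables. On the kernel
of `∂` this permits a descent in the index of the variable. -/
theorem pderiv_succ_dPoly (n : ℕ) (p : DiffPoly) :
    MvPolynomial.pderiv (n + 1) (dPoly p) =
      MvPolynomial.pderiv n p + dPoly (MvPolynomial.pderiv (n + 1) p) := by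
  have h : ⁅(MvPolynomial.pderiv (n + 1) : Derivation ℚ DiffPoly DiffPoly), dPoly⁆ =
      MvPolynomial.pderiv n := by
    apply MvPolynomial.derivation_ext
    intro i
    rw [Derivation.commutator_apply, dPoly_uVar, MvPolynomial.pderiv_X, MvPolynomial.pderiv_X,
      MvPolynomial.pderiv_X]
    have : dPoly (Pi.single (M := fun _ => DiffPoly) (n + 1) 1 i) = 0 := by
      rw [Pi.single_apply]
      split_ifs <;> simp
    rw [this, sub_zero, Pi.single_apply, Pi.single_apply]
    simp
  have h2 := DFunLike.congr_fun h p
  rw [Derivation.commutator_apply] at h2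
  linear_combination h2

/-- Only the constants are annihilated by `∂`. -/
theorem eq_zero_of_dPoly_eq_zero {p : DiffPoly} (h : dPoly p = 0)
    (h0 : MvPolynomial.constantCoeff p = 0) : p = 0 := by
  obtain ⟨N, hN⟩ : ∃ N, ∀ n ≥ N, MvPolynomial.pderiv n p = 0 := by
    refine ⟨p.vars.sup id + 1, fun n hn =>
      MvPolynomial.pderiv_eq_zero_of_notMem_vars fun hmem => ?_⟩
    have := Finset.le_sup (f := id) hmem
    simp only [id] at this
    omega
  -- Descending induction from an index beyond all variables of `p`: if `∂ p = 0` and `∂p/∂u_{n+1} =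
  -- 0`, the commutator gives `∂p/∂u_n = 0`.
  have key : ∀ k n, N ≤ n + k → MvPolynomial.pderiv n p = 0 := by
    intro k
    induction k with
    | zero => exact fun n hn => hN n hn
    | succ k ih =>
      intro n hn
      have h1 := pderiv_succ_dPoly n p
      rw [h, ih (n + 1) (by omega), map_zero, map_zero, add_zero] at h1
      exact h1.symm
  have h1 : (p : MvPowerSeries ℕ ℚ) = ((0 : DiffPoly) : MvPowerSeries ℕ ℚ) := by
    apply MvPowerSeries.pderiv.ext
    · intro i
      rw [MvPowerSeries.pderiv_coe, MvPowerSeries.pderiv_coe, key N i (by omega), map_zero]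
    · rw [← MvPowerSeries.coeff_zero_eq_constantCoeff_apply, MvPolynomial.coeff_coe]
      simpa [MvPolynomial.constantCoeff_eq] using h0
  exact MvPolynomial.coe_injective ℕ ℚ h1

theorem resolventCoeff_zero : resolventCoeff 0 = 1 := by rw [resolventCoeff]

theorem resolventCoeff_one : resolventCoeff 1 = uVar 0 := by
  rw [resolventCoeff]
  simp [resolventCoeff_zero]

theorem iterate_dPoly_uVar (n : ℕ) : dPoly^[n] (uVar 0) = uVar n := by
  induction n with
  | zero => rfl
  | succ n ih => rw [Function.iterate_succ_apply', ih, dPoly_uVar]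

theorem kdvDer_zero : kdvDer 0 = dPoly := by
  apply MvPolynomial.derivation_ext
  intro i
  rw [kdvDer, MvPolynomial.mkDerivation_X, resolventCoeff_one, iterate_dPoly_uVar, dPoly_uVar]
  simp

theorem doubleFactorial_mul_kdvDer (q : ℕ) :
    ((Nat.doubleFactorial (2 * q + 1) : ℕ) : DiffPoly) * kdvDer q (uVar 0) =
      dPoly (resolventCoeff (q + 1)) := by
  rw [kdvDer, MvPolynomial.mkDerivation_X, ← mul_assoc, ← map_natCast MvPolynomial.C, ← map_mul,
    mul_one_div_cancel (Nat.cast_ne_zero.2 (Nat.doubleFactorial_pos _).ne')]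
  simp

/-- The defining recursion is the coefficient of `X ^ (m + 1)`. The new coefficient enters `-4 b²`
through the two ends of the convolution, hence with the factor `-8` by which the recursion is
multiplied at the end. -/
theorem resolventEq_resolventCoeff :
    ResolventEq (A := PowerSeries DiffPoly) (coeffDer Unit dPoly) PowerSeries.X
      (PowerSeries.C (uVar 0)) (PowerSeries.mk resolventCoeff) := by
  have hc : ∀ (m : ℕ) (P : PowerSeries DiffPoly),
      PowerSeries.coeff m (coeffDer Unit dPoly P : PowerSeries DiffPoly) =
        dPoly (PowerSeries.coeff m P) := fun _ _ => rfl
  unfold ResolventEq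
  ext1 m
  cases m with
  | zero => simp [pow_two, resolventCoeff_zero,
      show (4 : PowerSeries DiffPoly) = PowerSeries.C 4 from (map_ofNat PowerSeries.C 4).symm]
  | succ m =>
    have hC : ∀ (c : DiffPoly) (P : PowerSeries DiffPoly), PowerSeries.coeff m
        (PowerSeries.C c * P) = c * PowerSeries.coeff m P :=
      fun c P => PowerSeries.coeff_C_mul _ _ _
    have h8 : (8 : PowerSeries DiffPoly) = PowerSeries.C 8 := (map_ofNat PowerSeries.C 8).symm
    have h4 : (4 : PowerSeries DiffPoly) = PowerSeries.C 4 := (map_ofNat PowerSeries.C 4).symm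
    have h2 : (2 : PowerSeries DiffPoly) = PowerSeries.C 2 := (map_ofNat PowerSeries.C 2).symm
    have e1 : ∑ k ∈ range (m + 1).succ, resolventCoeff k * resolventCoeff (m + 1 - k) =
        2 * resolventCoeff (m + 1)
          + ∑ i : Fin m, resolventCoeff (i + 1) * resolventCoeff (m - i) := by
      rw [Finset.sum_range_succ, Finset.sum_range_succ', Finset.sum_range fun k =>
        resolventCoeff (k + 1) * resolventCoeff (m + 1 - (k + 1))]
      simp only [Nat.add_sub_add_right, Nat.sub_self, Nat.sub_zero, resolventCoeff_zero]
      ring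
    have e2 := resolventCoeff.eq_2 m
    simp only [Finset.sum_add_distrib, Finset.sum_sub_distrib, ← Finset.mul_sum] at e2
    rw [map_sub, PowerSeries.coeff_succ_X_mul, h8, h4, h2, ← map_mul, pow_two, pow_two, map_add,
      map_sub, hC, hC, PowerSeries.coeff_C_mul, PowerSeries.coeff_mul, PowerSeries.coeff_mul,
      PowerSeries.coeff_mul, PowerSeries.coeff_mul, ← map_neg, PowerSeries.coeff_C,
      if_neg (Nat.succ_ne_zero m)]
    simp only [hc, PowerSeries.coeff_mk, Finset.Nat.sum_antidiagonal_eq_sum_range_succ_mk]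
    rw [e1]
    simp only [Finset.sum_range]
    have c2 : (2 : DiffPoly) * MvPolynomial.C (1 / 2) = 1 := by
      rw [← map_ofNat MvPolynomial.C 2, ← map_mul]; norm_num
    have c4 : (4 : DiffPoly) * MvPolynomial.C (1 / 4) = 1 := by
      rw [← map_ofNat MvPolynomial.C 4, ← map_mul]; norm_num
    have c8 : (8 : DiffPoly) * MvPolynomial.C (1 / 8) = 1 := by
      rw [← map_ofNat MvPolynomial.C 8, ← map_mul]; norm_num
    set a := ∑ x : Fin (m + 1), resolventCoeff x * dPoly (dPoly (resolventCoeff (m - x)))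
    set b := ∑ x : Fin (m + 1), dPoly (resolventCoeff x) * dPoly (resolventCoeff (m - x))
    set c := ∑ i : Fin m, resolventCoeff (i + 1) * resolventCoeff (m - i)
    linear_combination (-8) * e2 - 2 * a * c4 + b * c8 + 4 * c * c2

/-- The KdV derivations of the ring of differential polynomials. -/
theorem isKdVFlow_diffPoly : IsKdVFlow kdvDer (uVar 0) resolventCoeff where
  zero := resolventCoeff_zero
  resolvent := by rw [kdvDer_zero]; exact resolventEq_resolventCoeff
  comm q f := by rw [kdvDer_zero]; exact kdvDer_dPoly q f
  flow q := by rw [kdvDer_zero]; exact doubleFactorial_mul_kdvDer q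

variable {σ : Type*}

theorem map_constantCoeff_coeffDer (f : MvPowerSeries σ DiffPoly) :
    MvPowerSeries.map MvPolynomial.constantCoeff (coeffDer σ (kdvDer 0) f) = 0 := by
  ext e
  rw [MvPowerSeries.coeff_map, coeff_coeffDer, kdvDer_zero, constantCoeff_dPoly, map_zero]

/-- At `u = 0` all derivatives drop out and the resolvent equation becomes `4 * (r + 1) * (r - 1) =
0`, where `r + 1` has constant term `2`. -/
theorem map_constantCoeff_resSeries (j : σ) :
    MvPowerSeries.map MvPolynomial.constantCoeff (resSeries resolventCoeff j) = 1 := by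
  set φ := MvPowerSeries.map (σ := σ) (MvPolynomial.constantCoeff (σ := ℕ) (R := ℚ)) with hφ
  have h := congrArg φ (isKdVFlow_diffPoly.resolventEq j)
  have hu0 : φ (MvPowerSeries.C (uVar 0)) = 0 := by simp [hφ]
  simp only [map_sub, map_mul, map_add, map_pow, map_neg, map_ofNat, hφ,
    map_constantCoeff_coeffDer] at h
  rw [← hφ, hu0] at h
  have hc : MvPowerSeries.constantCoeff (φ (resSeries resolventCoeff j)) = 1 := by
    rw [hφ, MvPowerSeries.constantCoeff_map, isKdVFlow_diffPoly.constantCoeff_resSeries, map_one]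
  have hu : IsUnit (4 * (φ (resSeries resolventCoeff j) + 1)) := by
    rw [MvPowerSeries.isUnit_iff_constantCoeff]
    simp only [map_mul, map_add, hc, map_one, map_ofNat]
    norm_num
  rw [← sub_eq_zero]
  apply hu.mul_left_cancel
  linear_combination -h

theorem constantCoeff_resolventCoeff_succ (m : ℕ) :
    MvPolynomial.constantCoeff (resolventCoeff (m + 1)) = 0 := by
  have h := congrArg (MvPowerSeries.coeff (Finsupp.single () (2 * (m + 1))))
    (map_constantCoeff_resSeries ())
  rw [MvPowerSeries.coeff_map, resSeries, coeff_varSeries, MvPowerSeries.coeff_one,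
    if_neg (c := Finsupp.single () (2 * (m + 1)) = 0)
      (by rw [Finsupp.single_eq_zero]; omega)] at h
  simpa using h

variable {Ω : ℕ → ℕ → DiffPoly}

/-- By symmetry and the tau-structure axiom, `D_0 Ω_{p,0} = D_p Ω_{0,0} = D_p u₀`, so both sides
have the same `∂`-derivative. Both vanish at the origin, and `∂` annihilates only constants. -/
theorem IsCanonicalTauStructure.zero_left (hΩ : IsCanonicalTauStructure Ω) (p : ℕ) :
    Ω p 0 * ((Nat.doubleFactorial (2 * p + 1) : ℕ) : DiffPoly) = resolventCoeff (p + 1) := by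
  rw [← sub_eq_zero]
  apply eq_zero_of_dPoly_eq_zero
  · rw [map_sub, derivation_mul_natCast, ← doubleFactorial_mul_kdvDer, ← kdvDer_zero, hΩ.symm p 0,
      hΩ.der 0 p 0, hΩ.zero_zero, mul_comm, sub_self]
  · simp [hΩ.vanish, constantCoeff_resolventCoeff_succ]

/-- The `x`-derivative of the two-point series. -/
theorem IsCanonicalTauStructure.coeffDer_twoPoint (hΩ : IsCanonicalTauStructure Ω) {i j : σ}
    (hij : i ≠ j) : coeffDer σ (kdvDer 0) (corrSeries (multiOmega Ω) [i, j]) =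
      vertexDer kdvDer i (resSeries resolventCoeff j) := by
  classical
  -- The resolvent series is, up to its constant term, the generating series of the `Ω_{p,0}`.
  have h1 : resSeries resolventCoeff j =
      1 + corrSeries (fun ps => Ω (ps.headD 0) 0) [j] := by
    ext1 e
    rw [resSeries, coeff_varSeries, map_add, coeff_corrSeries, MvPowerSeries.coeff_one]
    by_cases he : e = Finsupp.single j (e j)
    · rcases Nat.even_or_odd (e j) with ⟨m, hm⟩ | ho
      · rw [if_pos ⟨he, by omega⟩, PowerSeries.coeff_mk]
        cases m with
        | zero =>
          rw [if_pos (by rw [he, hm]; simp), if_neg (by simp [hm]), hm, resolventCoeff_zero,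
            add_zero]
        | succ m =>
          rw [if_neg, if_pos]
          · simp only [List.map_cons, List.map_nil, List.headD_cons, List.prod_cons,
              List.prod_nil, mul_one]
            rw [hΩ.zero_left, zero_add]
            congr 1
            omega
          · refine ⟨by simp [hm]; omega, fun k hk => ?_⟩
            rw [he, Finsupp.single_eq_of_ne (by simpa using hk)]
          · intro h0
            rw [h0] at hm
            simp at hm
      · rw [if_neg, if_neg, if_neg, add_zero]
        · rintro ⟨h, -⟩
          exact (Nat.not_even_iff_odd.2 ho) (h j (by simp)).1
        · intro h0
          rw [h0] at ho
          simp at ho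
        · rintro ⟨-, h⟩
          exact (Nat.not_even_iff_odd.2 ho) (even_iff_two_dvd.2 h)
    · rw [if_neg (fun h => he h.1), if_neg, if_neg, add_zero]
      · rintro ⟨-, h⟩
        apply he
        ext k
        by_cases hk : k = j
        · simp [hk]
        · rw [h k (by simpa using hk), Finsupp.single_eq_of_ne hk]
      · intro h0
        apply he
        simp [h0]
  rw [h1, map_add, Derivation.map_one_eq_zero, zero_add, coeffDer_corrSeries]
  -- The insertion lemma takes one function for all lengths. Here it is `Ω_{p,0}` on one index and
  -- `∂ Ω_{p,q}` on two, and the condition to check is `D_0 Ω_{p,q} = D_p Ω_{q,0}`.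
  let om : List ℕ → DiffPoly := fun ps => match ps with
    | [p, q] => kdvDer 0 (Ω p q)
    | ps => Ω (ps.headD 0) 0
  have h2 : ∀ l : List σ, l.length = 1 →
      corrSeries (fun ps => Ω (ps.headD 0) 0) l = corrSeries om l := by
    intro l hl
    match l, hl with
    | [k], _ => rfl
  have h3 : corrSeries (fun ps => kdvDer 0 (multiOmega Ω ps)) [i, j] = corrSeries om [i, j] := rfl
  rw [h2 _ rfl, h3, vertexDer_corrSeries kdvDer om (by simpa using hij)]
  intro p ps hps
  match ps, hps with
  | [q], _ =>
    change kdvDer 0 (Ω p q) = kdvDer p (Ω q 0)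
    rw [hΩ.symm p q, hΩ.der]

/-- The two-point series is a quadratic expression in the resolvent series. -/
theorem IsCanonicalTauStructure.twoPoint (hΩ : IsCanonicalTauStructure Ω) {i j : σ}
    (hij : i ≠ j) {X Y u r s : MvPowerSeries σ DiffPoly} {D : Derivation ℚ
      (MvPowerSeries σ DiffPoly) (MvPowerSeries σ DiffPoly)}
    (hX : X = MvPowerSeries.X i ^ 2) (hY : Y = MvPowerSeries.X j ^ 2)
    (hu : u = MvPowerSeries.C (uVar 0)) (hr : r = resSeries resolventCoeff i)
    (hs : s = resSeries resolventCoeff j) (hD : D = coeffDer σ dPoly) :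
    2 * (X - Y) ^ 2 * corrSeries (multiOmega Ω) [i, j] =
      X * Y * (X * Y * D r * D s - r * X * (Y * D (D s) - 2 * (1 - 2 * u * Y) * s)
        - s * Y * (X * D (D r) - 2 * (1 - 2 * u * X) * r) - 2 * X - 2 * Y) := by
  have hdX : coeffDer σ (kdvDer 0) X = 0 := by simp [hX, Derivation.leibniz_pow]
  have hdY : coeffDer σ (kdvDer 0) Y = 0 := by simp [hY, Derivation.leibniz_pow]
  have tX := (isKdVFlow_diffPoly.resolventEq i).third (isKdVFlow_diffPoly.isUnit_resSeries i)
    (hX ▸ hdX)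
  have tY := (isKdVFlow_diffPoly.resolventEq j).third (isKdVFlow_diffPoly.isUnit_resSeries j)
    (hY ▸ hdY)
  have hv := isKdVFlow_diffPoly.vertexDer_resSeries i j
  rw [← kdvDer_zero] at hD
  rw [← hX, ← hu, ← hr] at tX
  rw [← hY, ← hu, ← hs] at tY
  rw [← hX, ← hY, ← hr, ← hΩ.coeffDer_twoPoint hij, ← hs] at hv
  set φ := MvPowerSeries.map (σ := σ) (MvPolynomial.constantCoeff (σ := ℕ) (R := ℚ)) with hφ
  have φD : ∀ f, φ (D f) = 0 := by rw [hD]; exact map_constantCoeff_coeffDer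
  have φr : φ r = 1 := by rw [hr]; exact map_constantCoeff_resSeries i
  have φs : φ s = 1 := by rw [hs]; exact map_constantCoeff_resSeries j
  have φu : φ u = 0 := by simp [hφ, hu]
  have φG : φ (corrSeries (multiOmega Ω) [i, j]) = 0 := by
    classical
    rw [hφ, map_corrSeries]
    ext e
    rw [coeff_corrSeries]
    simp [multiOmega, hΩ.vanish]
  set G := corrSeries (multiOmega Ω) [i, j]
  rw [← sub_eq_zero]
  set H := 2 * (X - Y) ^ 2 * G - X * Y * (X * Y * D r * D s
    - r * X * (Y * D (D s) - 2 * (1 - 2 * u * Y) * s)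
    - s * Y * (X * D (D r) - 2 * (1 - 2 * u * X) * r) - 2 * X - 2 * Y) with hH
  -- At `u = 0` both resolvent series are `1` and their derivatives vanish; the terms `- 2 * X - 2 *
  -- Y` are there to make the bracket zero.
  have φH : φ H = 0 := by
    rw [hH]
    simp only [map_sub, map_mul, map_pow, map_one, map_ofNat, φD, φr, φs, φu, φG]
    ring
  -- The derivative of the bracket contains third derivatives, which the third-order resolvent
  -- equations remove. What remains is the known derivative of the two-point series.
  have dH : coeffDer σ (kdvDer 0) H = 0 := by
    rw [← hD] at hdX hdY tX tY hv ⊢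
    have h2 : D 2 = 0 := by simpa using D.map_natCast 2
    rw [hH]
    simp only [map_sub, Derivation.leibniz, Derivation.leibniz_pow, smul_eq_mul,
      nsmul_eq_mul, hdX, hdY, h2, Derivation.map_one_eq_zero]
    linear_combination 2 * (X - Y) * hv + X * Y * X * r * tY + X * Y * Y * s * tX
  ext1 e
  apply eq_zero_of_dPoly_eq_zero
  · rw [← kdvDer_zero, ← coeff_coeffDer, dH, map_zero]
  · rw [← MvPowerSeries.coeff_map, ← hφ, φH, map_zero]

end DiffPolys

/-! ### The flows along a solution -/

section SolutionFlow

variable {W : Type*} [CommRing W] [Algebra ℚ W] {δ : Derivation ℚ W W} {u : TimeSeries W}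

theorem evalAt_dPoly (p : DiffPoly) : evalAt δ u (dPoly p) = xDer δ (evalAt δ u p) := by
  induction p using MvPolynomial.induction_on with
  | C a => simp [← MvPolynomial.algebraMap_eq]
  | add p q hp hq => simp [hp, hq]
  | mul_X p i hp =>
    have h : ∀ i, evalAt δ u (MvPolynomial.X i) = (xDer δ)^[i] u := fun i =>
      MvPolynomial.aeval_X _ _
    rw [Derivation.leibniz, map_add, smul_eq_mul, smul_eq_mul, map_mul, map_mul, map_mul,
      Derivation.leibniz, hp, dPoly_uVar, h, h, Function.iterate_succ_apply', smul_eq_mul,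
      smul_eq_mul]

theorem evalAt_iterate_dPoly (n : ℕ) (p : DiffPoly) :
    evalAt δ u (dPoly^[n] p) = (xDer δ)^[n] (evalAt δ u p) := by
  induction n with
  | zero => rfl
  | succ n ih => rw [Function.iterate_succ_apply', evalAt_dPoly, ih, Function.iterate_succ_apply']

theorem timeDer_xDer (q : ℕ) (f : TimeSeries W) :
    timeDer δ q (xDer δ f) = xDer δ (timeDer δ q f) := by
  cases q with
  | zero => rfl
  | succ q =>
    ext m
    have hx : ∀ (f : TimeSeries W) (m), MvPowerSeries.coeff m (xDer δ f) =
      δ (MvPowerSeries.coeff m f) := fun _ _ => rfl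
    change MvPowerSeries.coeff m (MvPowerSeries.pderiv W q.succPNat (xDer δ f)) =
      δ (MvPowerSeries.coeff m (MvPowerSeries.pderiv W q.succPNat f))
    rw [MvPowerSeries.coeff_pderiv, MvPowerSeries.coeff_pderiv, hx]
    have := derivation_mul_natCast δ
      (MvPowerSeries.coeff (m + Finsupp.single q.succPNat 1) f) (m q.succPNat + 1)
    push_cast at this
    exact this.symm

theorem timeDer_iterate_xDer (q n : ℕ) (f : TimeSeries W) :
    timeDer δ q ((xDer δ)^[n] f) = (xDer δ)^[n] (timeDer δ q f) := by
  induction n with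
  | zero => rfl
  | succ n ih => rw [Function.iterate_succ_apply', timeDer_xDer, ih, Function.iterate_succ_apply']

theorem kdvDer_iterate_dPoly (q n : ℕ) (p : DiffPoly) :
    kdvDer q (dPoly^[n] p) = dPoly^[n] (kdvDer q p) := by
  induction n with
  | zero => rfl
  | succ n ih => rw [Function.iterate_succ_apply', kdvDer_dPoly, ih, Function.iterate_succ_apply']

/-- It suffices to check the variables `u_i = ∂^i u₀`. Both flows commute with the x-derivative,
which reduces this to `u₀`, where it is the definition of a solution. -/
theorem IsSolution.evalAt_kdvDer (hu : IsSolution δ u) (q : ℕ) (p : DiffPoly) :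
    evalAt δ u (kdvDer q p) = timeDer δ q (evalAt δ u p) := by
  induction p using MvPolynomial.induction_on with
  | C a => simp [← MvPolynomial.algebraMap_eq]
  | add p q hp hq => simp [hp, hq]
  | mul_X p i hp =>
    have h : evalAt δ u (kdvDer q (MvPolynomial.X i)) =
        timeDer δ q (evalAt δ u (MvPolynomial.X i)) := by
      rw [show (MvPolynomial.X i : DiffPoly) = dPoly^[i] (uVar 0) from
        (iterate_dPoly_uVar i).symm, kdvDer_iterate_dPoly, evalAt_iterate_dPoly, ← hu q,
        evalAt_iterate_dPoly, timeDer_iterate_xDer]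
      congr 3
      exact (MvPolynomial.aeval_X (fun i => (xDer δ)^[i] u) 0).symm
    rw [Derivation.leibniz, map_add, smul_eq_mul, smul_eq_mul, map_mul, map_mul, map_mul,
      Derivation.leibniz, hp, h, smul_eq_mul, smul_eq_mul]

/-- The coefficients of the resolvent series of `u`. -/
def resValue (δ : Derivation ℚ W W) (u : TimeSeries W) (m : ℕ) : TimeSeries W :=
  evalAt δ u (resolventCoeff m)

theorem IsSolution.isKdVFlow (hu : IsSolution δ u) :
    IsKdVFlow (timeDer δ) u (resValue δ u) where
  zero := by rw [resValue, resolventCoeff_zero, map_one]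
  resolvent := by
    have h := resolventEq_resolventCoeff.map (PowerSeries.map (evalAt δ u).toRingHom)
      (D' := coeffDer Unit (xDer δ)) (by
        intro f
        ext1 m
        exact evalAt_dPoly (PowerSeries.coeff m f))
    have hu : (evalAt δ u).toRingHom (uVar 0) = u := MvPolynomial.aeval_X _ 0
    rw [PowerSeries.map_X, PowerSeries.map_C, hu] at h
    exact h
  comm q f := timeDer_xDer q f
  flow q := by
    rw [hu q, ← map_natCast (evalAt δ u), ← map_mul, doubleFactorial_mul_kdvDer]
    exact evalAt_dPoly _

end SolutionFlow

/-! ### Laurent series -/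

section Laurent

variable {R : Type*} [CommRing R] [Algebra ℚ R]

/-- The derivation of the Laurent series that applies `d` to all coefficients, as an additive
map. -/
def laurentDer (d : Derivation ℚ R R) : LaurentSeries R →+ LaurentSeries R where
  toFun f := f.map d
  map_zero' := by ext n; simp
  map_add' := by intro f g; ext n; simp

theorem laurentDer_mul (d : Derivation ℚ R R) (f g : LaurentSeries R) :
    laurentDer d (f * g) = f * laurentDer d g + g * laurentDer d f := by
  -- With this inclusion all three convolution sums can be taken over the same finite set of pairs.
  have hs : ∀ h : LaurentSeries R, (h.map d).support ⊆ h.support := by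
    intro h n hn h0
    exact hn ((congrArg d h0).trans (map_zero d))
  ext n
  change d ((f * g).coeff n) = (f * g.map d + g * f.map d).coeff n
  rw [mul_comm g, HahnSeries.coeff_add,
    HahnSeries.coeff_mul_right' g.isPWO_support (hs g),
    HahnSeries.coeff_mul_left' f.isPWO_support (hs f),
    HahnSeries.coeff_mul, map_sum, ← Finset.sum_add_distrib]
  refine Finset.sum_congr rfl fun p _ => ?_
  rw [Derivation.leibniz, smul_eq_mul, smul_eq_mul, mul_comm (g.coeff p.2)]
  rfl

theorem coeff_laurentDer (d : Derivation ℚ R R) (f : LaurentSeries R) (n : ℤ) :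
    (laurentDer d f).coeff n = d (f.coeff n) := rfl

theorem laurentDer_C (d : Derivation ℚ R R) (c : R) :
    laurentDer d (HahnSeries.C c) = HahnSeries.C (d c) := by
  ext n
  rw [coeff_laurentDer, HahnSeries.C_apply, HahnSeries.C_apply, HahnSeries.coeff_single,
    HahnSeries.coeff_single]
  split_ifs <;> simp

theorem laurentDer_single_one (d : Derivation ℚ R R) (m : ℤ) :
    laurentDer d (HahnSeries.single m 1) = 0 := by
  ext n
  rw [coeff_laurentDer, HahnSeries.coeff_single]
  split_ifs <;> simp

theorem laurentDer_ofPowerSeries (d : Derivation ℚ R R) (f : PowerSeries R) :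
    laurentDer d (HahnSeries.ofPowerSeries ℤ R f) =
      HahnSeries.ofPowerSeries ℤ R (coeffDer Unit d f : PowerSeries R) := by
  ext n
  rw [coeff_laurentDer, PowerSeries.coeff_coe, PowerSeries.coeff_coe]
  split_ifs
  · simp
  · rfl

/-- Multiplication by the first power of `z`. -/
theorem coeff_single_neg_mul (k : ℤ) (f : LaurentSeries R) (n : ℤ) :
    (HahnSeries.single (-k) (1 : R) * f).coeff n = f.coeff (n + k) := by
  have h := HahnSeries.coeff_single_mul_add (r := (1 : R)) (x := f) (a := n + k) (b := -k)
  rw [one_mul] at h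
  rw [← h]
  congr 1
  ring

/-- Laurent series without odd powers. -/
def evenSubring (R : Type*) [CommRing R] : Subring (LaurentSeries R) where
  carrier := {f | ∀ n, Odd n → f.coeff n = 0}
  zero_mem' := by intro n _; simp
  one_mem' := by
    intro n hn
    rw [HahnSeries.coeff_one, if_neg]
    rintro rfl
    simp at hn
  add_mem' := by
    intro f g hf hg n hn
    rw [HahnSeries.coeff_add, hf n hn, hg n hn, add_zero]
  neg_mem' := by
    intro f hf n hn
    rw [HahnSeries.coeff_neg, hf n hn, neg_zero]
  mul_mem' := by
    intro f g hf hg n hn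
    rw [HahnSeries.coeff_mul]
    refine Finset.sum_eq_zero fun p hp => ?_
    have h : p.1 + p.2 = n := (Finset.mem_antidiagonal.1 hp).2.2
    rcases Int.even_or_odd p.1 with h1 | h1
    · have h2 : Odd p.2 := by
        rw [← h] at hn
        exact (Int.odd_add.1 hn).not.1 (by simpa using h1) |> Int.not_even_iff_odd.1
      rw [hg _ h2, mul_zero]
    · rw [hf _ h1, zero_mul]

theorem laurentDer_mem_evenSubring (d : Derivation ℚ R R) {f : LaurentSeries R}
    (hf : f ∈ evenSubring R) : laurentDer d f ∈ evenSubring R := by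
  intro n hn
  rw [coeff_laurentDer, hf n hn, map_zero]

theorem single_mem_evenSubring {m : ℤ} (hm : Even m) (c : R) :
    HahnSeries.single m c ∈ evenSubring R := by
  intro n hn
  rw [HahnSeries.coeff_single, if_neg]
  rintro rfl
  exact Int.not_even_iff_odd.2 hn hm

theorem eq_ofPowerSeries_of_coeff_neg {f : LaurentSeries R} (hf : ∀ n < 0, f.coeff n = 0) :
    ∃ F : PowerSeries R, f = HahnSeries.ofPowerSeries ℤ R F := by
  refine ⟨PowerSeries.mk fun n => f.coeff n, ?_⟩
  ext n
  rw [PowerSeries.coeff_coe]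
  split_ifs with h
  · exact hf n h
  · rw [PowerSeries.coeff_mk, Int.natAbs_of_nonneg (not_lt.1 h)]

end Laurent

/-! ### Products of a wave function and the dual wave function -/

section Wave

variable {R : Type*} [CommRing R] [Algebra ℚ R] {d : Derivation ℚ R R} {u : R}

/-- If `ψ = a e^θ` solves `L ψ = z^2 ψ` and all `∂_x^i ψ ψ^*` have no residue, then
`z^(2k) ∂_x^i ψ ψ^*` has no residue. -/
theorem residue_eq_zero {a b z : LaurentSeries R} (hz : z = HahnSeries.single (-1) 1)
    {T : LaurentSeries R → LaurentSeries R} (hT : ∀ f, T f = laurentDer d f + z * f)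
    (ha : T (T a) + HahnSeries.C (2 * u) * a = z ^ 2 * a)
    (hres : ∀ i, (T^[i] a * b).coeff 1 = 0) (k i : ℕ) :
    ((z ^ 2) ^ k * T^[i] a * b).coeff 1 = 0 := by
  -- The `R`-span of all `∂_x^i ψ` is closed under `∂_x`, hence under `L`. Multiplication by `z²`
  -- acts on `ψ` as `L` and commutes with `∂_x`, so it preserves the span too, and the residue
  -- condition is `R`-linear on the span.
  set M := Submodule.span R (Set.range fun i => T^[i] a) with hM
  have hdz : laurentDer d z = 0 := by rw [hz, laurentDer_single_one]
  have hzz : laurentDer d (z ^ 2) = 0 := by rw [pow_two, laurentDer_mul, hdz, mul_zero, add_zero]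
  have hsm : ∀ (c : R) (f : LaurentSeries R), c • f = HahnSeries.C c * f := fun c f =>
    (HahnSeries.C_mul_eq_smul).symm
  have hadd : ∀ f g, T (f + g) = T f + T g := by
    intro f g; rw [hT, hT, hT, map_add]; ring
  have hTM : ∀ f ∈ M, T f ∈ M := by
    intro f hf
    induction hf using Submodule.span_induction with
    | mem f hf =>
      obtain ⟨i, rfl⟩ := hf
      exact Submodule.subset_span ⟨i + 1, Function.iterate_succ_apply' _ _ _⟩
    | zero => rw [hT, map_zero, mul_zero, add_zero]; exact M.zero_mem
    | add f g _ _ hf hg => rw [hadd]; exact M.add_mem hf hg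
    | smul c f hfM hf =>
      have : T (c • f) = d c • f + c • T f := by
        rw [hT, hT, hsm, hsm, hsm, laurentDer_mul, laurentDer_C]
        ring
      rw [this]
      exact M.add_mem (M.smul_mem _ hfM) (M.smul_mem _ hf)
  have hTiM : ∀ (i : ℕ), ∀ f ∈ M, T^[i] f ∈ M := by
    intro i
    induction i with
    | zero => exact fun f hf => hf
    | succ i ih =>
      intro f hf
      rw [Function.iterate_succ_apply']
      exact hTM _ (ih f hf)
  have hTz : ∀ (i : ℕ) f, z ^ 2 * T^[i] f = T^[i] (z ^ 2 * f) := by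
    intro i
    induction i with
    | zero => exact fun f => rfl
    | succ i ih =>
      intro f
      rw [Function.iterate_succ_apply, ih, Function.iterate_succ_apply, hT, hT,
        laurentDer_mul, hzz]
      congr 1
      ring
  have haM : a ∈ M := Submodule.subset_span ⟨0, rfl⟩
  have hzM : ∀ f ∈ M, z ^ 2 * f ∈ M := by
    intro f hf
    induction hf using Submodule.span_induction with
    | mem f hf =>
      obtain ⟨i, rfl⟩ := hf
      change z ^ 2 * T^[i] a ∈ M
      rw [hTz, ← ha, ← hsm]
      exact hTiM i _ (M.add_mem (hTM _ (hTM _ haM)) (M.smul_mem _ haM))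
    | zero => rw [mul_zero]; exact M.zero_mem
    | add f g _ _ hf hg => rw [mul_add]; exact M.add_mem hf hg
    | smul c f _ hf =>
      rw [hsm, mul_left_comm, ← hsm]
      exact M.smul_mem _ hf
  have hrM : ∀ f ∈ M, (f * b).coeff 1 = 0 := by
    intro f hf
    induction hf using Submodule.span_induction with
    | mem f hf =>
      obtain ⟨i, rfl⟩ := hf
      exact hres i
    | zero => simp
    | add f g _ _ hf hg => rw [add_mul, HahnSeries.coeff_add, hf, hg, add_zero]
    | smul c f _ hf => rw [hsm, mul_assoc, ← hsm, HahnSeries.coeff_smul, hf, smul_zero]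
  apply hrM
  induction k with
  | zero => rw [pow_zero, one_mul]; exact hTiM i a haM
  | succ k ih => rw [pow_succ', mul_assoc]; exact hzM _ ih

/-- The series variable is `1/z`, so a factor `z^{2k}` moves the coefficient of index `2k + 1` to
the residue position. Vanishing residues of all `z^{2k} f` thus control every positive odd
coefficient of `f`. -/
theorem coeff_sq_pow_mul (f : LaurentSeries R) (k : ℕ) :
    (((HahnSeries.single (-1) (1 : R)) ^ 2) ^ k * f).coeff 1 = f.coeff (2 * k + 1) := by
  rw [← pow_mul, HahnSeries.single_pow, one_pow,
    show (2 * k) • (-1 : ℤ) = -((2 * k : ℕ) : ℤ) by simp, coeff_single_neg_mul]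
  congr 1
  push_cast
  ring

/-- The products of a wave function, a dual wave function and their derivatives: the product
`ψ ψ^*` solves the resolvent equation, and the Wronskian `ψ ψ^*_x - ψ_x ψ^*` is `-2z`. -/
theorem wave_products {a b a' b' z : LaurentSeries R} (hz : z = HahnSeries.single (-1) 1)
    {T : LaurentSeries R → LaurentSeries R} (hT : ∀ f, T f = laurentDer d f + z * f)
    (ha' : a' = T a) (hb' : b' = laurentDer d b - z * b)
    (ha : T a' + HahnSeries.C (2 * u) * a = z ^ 2 * a)
    (hb : laurentDer d b' - z * b' + HahnSeries.C (2 * u) * b = z ^ 2 * b)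
    (ha0 : a.coeff 0 = 1) (haneg : ∀ m < 0, a.coeff m = 0)
    (hb0 : b.coeff 0 = 1) (hbneg : ∀ m < 0, b.coeff m = 0)
    (hres : ∀ i, (T^[i] a * b).coeff 1 = 0) :
    a * b' - a' * b = - 2 * z ∧ ∃ F : PowerSeries R, a * b = HahnSeries.ofPowerSeries ℤ R F ∧
      MvPowerSeries.constantCoeff F = 1 ∧
      ResolventEq (coeffDer Unit d) (MvPowerSeries.X () ^ 2) (MvPowerSeries.C u) F := by
  obtain ⟨A, rfl⟩ := eq_ofPowerSeries_of_coeff_neg haneg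
  obtain ⟨B, rfl⟩ := eq_ofPowerSeries_of_coeff_neg hbneg
  set ι := HahnSeries.ofPowerSeries ℤ R with hι
  set Dx := laurentDer d with hDx
  set U := HahnSeries.C (Γ := ℤ) u with hU
  have hCU : HahnSeries.C (Γ := ℤ) (2 * u) = 2 * U := by rw [map_mul, map_ofNat]
  rw [hCU] at ha hb
  have hneg : ∀ (F : PowerSeries R) (n : ℤ), n < 0 → (ι F).coeff n = 0 := by
    intro F n hn
    rw [hι, PowerSeries.coeff_coe, if_pos hn]
  have hdz : Dx z = 0 := by rw [hz, hDx, laurentDer_single_one]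
  have hAB : MvPowerSeries.constantCoeff (A * B) = 1 := by
    have h1 : (ι A).coeff 0 = MvPowerSeries.constantCoeff A := by
      rw [hι, PowerSeries.coeff_coe, if_neg (lt_irrefl 0)]
      exact PowerSeries.coeff_zero_eq_constantCoeff_apply A
    have h2 : (ι B).coeff 0 = MvPowerSeries.constantCoeff B := by
      rw [hι, PowerSeries.coeff_coe, if_neg (lt_irrefl 0)]
      exact PowerSeries.coeff_zero_eq_constantCoeff_apply B
    rw [map_mul, ← h1, ← h2, ha0, hb0, one_mul]
  have hP0 : (ι (A * B)).coeff 0 = 1 := by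
    rw [hι, PowerSeries.coeff_coe, if_neg (lt_irrefl 0), ← hAB]
    exact PowerSeries.coeff_zero_eq_constantCoeff_apply (A * B)
  set ρ := ι A * ι B with hρ
  have hρP : ρ = ι (A * B) := by rw [map_mul]
  have hT' : ∀ f, T f = Dx f + z * f := hT
  rw [hT'] at ha ha'
  have res := residue_eq_zero hz hT (a := ι A) (b := ι B) (u := u)
    (by rw [hT, hT, hCU, ← ha, ha']) hres
  have odd_pos : ∀ n : ℤ, Odd n → n < 0 ∨ ∃ k : ℕ, n = 2 * k + 1 := by
    intro n hn
    rcases lt_or_ge n 0 with h | h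
    · exact Or.inl h
    · obtain ⟨m, hm⟩ := hn
      exact Or.inr ⟨m.toNat, by omega⟩
  have hρe : ρ ∈ evenSubring R := by
    intro n hn
    rcases odd_pos n hn with h | ⟨k, rfl⟩
    · rw [hρP, hneg _ _ h]
    · have h1 := res k 0
      rwa [hz, mul_assoc, coeff_sq_pow_mul] at h1
  have hdρ : Dx ρ = a' * ι B + ι A * b' := by
    rw [hρ, laurentDer_mul, ha', hb']; ring
  -- The defect of the Wronskian, to be shown zero. The form `hE1` shows that it has no negative
  -- powers of `1/z`, because `ρ` starts with `1`. The form `hE2` handles the positive odd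
  -- coefficients, by evenness of `ρ` and the residues of `ψ_x ψ*`.
  set E := ι A * b' - a' * ι B + 2 * z with hE
  have hE1 : E = ι (A * coeffDer Unit d B) - ι (coeffDer Unit d A * B)
      - 2 * (z * (ρ - 1)) := by
    rw [hE, map_mul, map_mul, hι, ← laurentDer_ofPowerSeries, ← laurentDer_ofPowerSeries, ← hι,
      ha', hb']
    ring
  have hE2 : E = Dx ρ - 2 * (a' * ι B) + 2 * z := by rw [hE, hdρ]; ring
  have hEe : E ∈ evenSubring R := by
    intro n hn
    rcases odd_pos n hn with h | ⟨k, rfl⟩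
    · have h3 : (z * (ρ - 1)).coeff n = 0 := by
        rw [hz, coeff_single_neg_mul, HahnSeries.coeff_sub, HahnSeries.coeff_one]
        rcases eq_or_ne n (-1) with rfl | h1
        · rw [neg_add_cancel, if_pos rfl, hρP, hP0, sub_self]
        · rw [hρP, hneg _ _ (by omega), if_neg (by omega), sub_zero]
      rw [hE1, HahnSeries.coeff_sub, HahnSeries.coeff_sub, hneg _ _ h, hneg _ _ h, two_mul,
        HahnSeries.coeff_add, h3]
      simp
    · have h1 : (a' * ι B).coeff (2 * k + 1) = 0 := by
        have h1 := res k 1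
        rw [hz, mul_assoc, coeff_sq_pow_mul] at h1
        rw [ha', ← hT']
        exact h1
      have h2 : z.coeff (2 * (k : ℤ) + 1) = 0 := by
        rw [hz, HahnSeries.coeff_single, if_neg (by omega)]
      rw [hE2, HahnSeries.coeff_add, HahnSeries.coeff_sub, two_mul (a' * ι B), two_mul z,
        HahnSeries.coeff_add, HahnSeries.coeff_add, h1, h2,
        laurentDer_mem_evenSubring d hρe _ hn]
      simp
  have hddρ : Dx (Dx ρ) = 2 * (z ^ 2 - 2 * U) * ρ + 2 * (a' * b') := by
    rw [hdρ, map_add, laurentDer_mul, laurentDer_mul]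
    have h1 : Dx (ι A) = a' - z * ι A := by rw [ha']; ring
    have h2 : Dx (ι B) = b' + z * ι B := by rw [hb']; ring
    rw [h1, h2, hρ]
    linear_combination ι B * ha + ι A * hb
  -- This rests on `W² = (ρ')² - 4 (ψψ*) (ψ_xψ*_x)`, with `ψ_xψ*_x` eliminated by means of `ρ''`.
  have hW2 : (ι A * b' - a' * ι B) ^ 2 =
      Dx ρ ^ 2 - 2 * ρ * Dx (Dx ρ) + 4 * (z ^ 2 - 2 * U) * ρ ^ 2 := by
    rw [hddρ, hdρ, hρ]
    ring
  have hz2 : z ^ 2 ∈ evenSubring R := by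
    rw [hz, HahnSeries.single_pow]
    exact single_mem_evenSubring (by decide) _
  have hUe : U ∈ evenSubring R := single_mem_evenSubring Even.zero _
  have h2e : (2 : LaurentSeries R) ∈ evenSubring R := by
    rw [← one_add_one_eq_two]; exact add_mem (one_mem _) (one_mem _)
  have h4e : (4 : LaurentSeries R) ∈ evenSubring R := by
    rw [← two_add_two_eq_four]; exact add_mem h2e h2e
  have hdρe := laurentDer_mem_evenSubring d hρe
  have hddρe := laurentDer_mem_evenSubring d hdρe
  -- Since `W = E - 2z`, we have `4zE = E² + 4z² - W²`, and every term on the right is even. So `E`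
  -- is odd as well as even, hence zero.
  have hzE : 4 * (z * E) ∈ evenSubring R := by
    have h1 : 4 * (z * E) = E ^ 2 + 4 * z ^ 2
        - (Dx ρ ^ 2 - 2 * ρ * Dx (Dx ρ) + 4 * (z ^ 2 - 2 * U) * ρ ^ 2) := by
      rw [← hW2, hE]; ring
    rw [h1]
    exact sub_mem (add_mem (pow_mem hEe 2) (mul_mem h4e hz2))
      (add_mem (sub_mem (pow_mem hdρe 2) (mul_mem (mul_mem h2e hρe) hddρe))
        (mul_mem (mul_mem h4e (sub_mem hz2 (mul_mem h2e hUe))) (pow_mem hρe 2)))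
  have hE0 : E = 0 := by
    ext n
    rcases Int.even_or_odd n with hn | hn
    · have h1 := hzE (n - 1) (by
        rw [Int.odd_sub]
        simp [hn])
      have h2 : 4 * (z * E) = z * (2 * (2 * E)) := by ring
      rw [h2, hz, coeff_single_neg_mul, sub_add_cancel, two_mul, HahnSeries.coeff_add, two_mul,
        HahnSeries.coeff_add] at h1
      rw [HahnSeries.coeff_zero]
      apply (isUnit_two.mul isUnit_two).mul_left_cancel
      linear_combination h1
    · exact hEe n hn
  have hW : ι A * b' - a' * ι B = -2 * z := by linear_combination hE0
  refine ⟨hW, A * B, hρP, hAB, ?_⟩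
  have hX : ι (MvPowerSeries.X ()) * z = 1 := by
    have : ι (MvPowerSeries.X ()) = HahnSeries.single 1 1 := HahnSeries.ofPowerSeries_X
    rw [this, hz, HahnSeries.single_mul_single]
    simp
  have hC : ι (MvPowerSeries.C u) = U := HahnSeries.ofPowerSeries_C u
  apply HahnSeries.ofPowerSeries_injective (Γ := ℤ) (R := R)
  rw [← hι]
  have hD : ∀ F, ι (coeffDer Unit d F) = Dx (ι F) := fun F => (laurentDer_ofPowerSeries d F).symm
  simp only [map_sub, map_mul, map_add, map_pow, map_neg, map_ofNat, hC, hD]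
  rw [← hρ]
  rw [hW] at hW2
  -- The resolvent equation is the formula for `W²` with `W² = 4z²`, divided by `z²`.
  linear_combination (ι (MvPowerSeries.X ()) ^ 2) * hW2
    + (4 * ρ ^ 2 - 4) * (ι (MvPowerSeries.X ()) * z + 1) * hX

end Wave

/-! ### The kernel of the cyclic products -/

section Kernel

variable {S ι : Type*} [CommRing S]

/-- The insertion formula for the kernel after all denominators are cleared. Each resolvent equation
enters with the squares of the other two `r` and the difference of the other two `z²`. -/
theorem insertion_polynomial_identity {ri rj rn pi pj pn qi qj qn zi zj zn U : S}
    (hi : 2 * (ri * qi) - pi ^ 2 + 8 * U * ri ^ 2 - 4 * zi ^ 2 * ri ^ 2 = -4 * zi ^ 2)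
    (hj : 2 * (rj * qj) - pj ^ 2 + 8 * U * rj ^ 2 - 4 * zj ^ 2 * rj ^ 2 = -4 * zj ^ 2)
    (hn : 2 * (rn * qn) - pn ^ 2 + 8 * U * rn ^ 2 - 4 * zn ^ 2 * rn ^ 2 = -4 * zn ^ 2) :
    rn * rj * (2 * ri * (-(ri * pn - rn * pi) * (zj ^ 2 - zn ^ 2) * (pj - 2 * zj)
        + ri * (zn ^ 2 - zi ^ 2) * (rj * qn - rn * qj)
        - (rj * pn - rn * pj) * (zn ^ 2 - zi ^ 2) * (pi + 2 * zi)
        + rj * (zj ^ 2 - zn ^ 2) * (ri * qn - rn * qi))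
        + 2 * (ri * (pj - 2 * zj) - rj * (pi + 2 * zi)) * (ri * pn - rn * pi)
          * (zj ^ 2 - zn ^ 2)) =
      -((zj ^ 2 - zi ^ 2) * ri * rj * (ri * (pn - 2 * zn) - rn * (pi + 2 * zi))
          * (rn * (pj - 2 * zj) - rj * (pn + 2 * zn)))
        - (ri * (pj - 2 * zj) - rj * (pi + 2 * zi)) * rn *
          ((rn * (pj + 2 * zj) - (pn - 2 * zn) * rj) * ri * (zn ^ 2 - zi ^ 2)
            + (rn * (pi + 2 * zi) - (pn - 2 * zn) * ri) * rj * (zj ^ 2 - zn ^ 2)) := by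
  linear_combination ri ^ 2 * rj ^ 2 * (zj ^ 2 - zi ^ 2) * hn
    - rn ^ 2 * ri ^ 2 * (zn ^ 2 - zi ^ 2) * hj - rn ^ 2 * rj ^ 2 * (zj ^ 2 - zn ^ 2) * hi

/-- The kernel `D(z_i, z_j)`, multiplied by `ψ(z_j) / ψ(z_i)` and expressed through the resolvent
series `r = ψ ψ^*`, its derivative `p` and `z`; twice its value. -/
def gaugedKernel (r p z : ι → S) (i j : ι) : S :=
  (r i * (p j - 2 * z j) - r j * (p i + 2 * z i)) * Ring.inverse (z j ^ 2 - z i ^ 2) *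
    Ring.inverse (r i) * Ring.inverse 2

/-- The logarithmic derivative of `ψ(z_i)` along the generating derivation at `z_n`, up to a
summand `1 / (z_n - z_i)` which comes from the exponential factor. -/
def logDer (r p z : ι → S) (n i : ι) : S :=
  (r n * (p i + 2 * z i) - (p n - 2 * z n) * r i) * Ring.inverse (z n ^ 2 - z i ^ 2) *
    Ring.inverse (r i) * Ring.inverse 2

theorem gaugedKernel_mul {r p z : ι → S} {i j : ι} (h2 : IsUnit (2 : S)) (hr : IsUnit (r i))
    (hz : IsUnit (z j ^ 2 - z i ^ 2)) :
    2 * (gaugedKernel r p z i j * (z j ^ 2 - z i ^ 2) * r i) =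
      r i * (p j - 2 * z j) - r j * (p i + 2 * z i) := by
  have e1 := Ring.mul_inverse_cancel _ h2
  have e2 := Ring.mul_inverse_cancel _ hr
  have e3 := Ring.mul_inverse_cancel _ hz
  calc 2 * (gaugedKernel r p z i j * (z j ^ 2 - z i ^ 2) * r i) =
      (r i * (p j - 2 * z j) - r j * (p i + 2 * z i)) *
        ((z j ^ 2 - z i ^ 2) * Ring.inverse (z j ^ 2 - z i ^ 2)) * (r i * Ring.inverse (r i)) *
          (2 * Ring.inverse 2) := by rw [gaugedKernel]; ring
    _ = _ := by rw [e1, e2, e3]; ring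

theorem logDer_mul {r p z : ι → S} {n i : ι} (h2 : IsUnit (2 : S)) (hr : IsUnit (r i))
    (hz : IsUnit (z n ^ 2 - z i ^ 2)) :
    2 * (logDer r p z n i * (z n ^ 2 - z i ^ 2) * r i) =
      r n * (p i + 2 * z i) - (p n - 2 * z n) * r i := by
  have e1 := Ring.mul_inverse_cancel _ h2
  have e2 := Ring.mul_inverse_cancel _ hr
  have e3 := Ring.mul_inverse_cancel _ hz
  calc 2 * (logDer r p z n i * (z n ^ 2 - z i ^ 2) * r i) =
      (r n * (p i + 2 * z i) - (p n - 2 * z n) * r i) *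
        ((z n ^ 2 - z i ^ 2) * Ring.inverse (z n ^ 2 - z i ^ 2)) * (r i * Ring.inverse (r i)) *
          (2 * Ring.inverse 2) := by rw [logDer]; ring
    _ = _ := by rw [e1, e2, e3]; ring

/-- Elements `r_i`, with first and second derivatives `p_i`, `q_i`, that solve the resolvent
equations with spectral parameters `z_i^2`. -/
structure ResolventSystem (r p q z : ι → S) (U : S) : Prop where
  isUnit_two : IsUnit (2 : S)
  isUnit_r : ∀ i, IsUnit (r i)
  isUnit_sub : ∀ i j, i ≠ j → IsUnit (z j ^ 2 - z i ^ 2)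
  eq : ∀ i, 2 * (r i * q i) - p i ^ 2 + 8 * U * r i ^ 2 - 4 * z i ^ 2 * r i ^ 2 = -4 * z i ^ 2

/-- The derivation `D` acts on the resolvents in the way of the generating derivation at `z_n`. -/
structure IsInsertion (r p q z : ι → S) (D : Derivation ℤ S S) (n : ι) : Prop where
  z_eq : ∀ i, D (z i) = 0
  r_eq : ∀ i, i ≠ n → D (r i) * (z i ^ 2 - z n ^ 2) = r i * p n - r n * p i
  p_eq : ∀ i, i ≠ n → D (p i) * (z i ^ 2 - z n ^ 2) = r i * q n - r n * q i

variable {r p q z : ι → S} {U : S}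

/-- The quadratic term splits the edge from `i` to `j` at `n`. The other term, a difference of
values at the two ends, is due to the factor `ψ(z_j) / ψ(z_i)` in the kernel. -/
theorem ResolventSystem.insertion_gaugedKernel (h : ResolventSystem r p q z U)
    {D : Derivation ℤ S S} {n : ι} (hD : IsInsertion r p q z D n) {i j : ι} (hij : i ≠ j)
    (hi : i ≠ n) (hj : j ≠ n) :
    D (gaugedKernel r p z i j) = -(gaugedKernel r p z i n * gaugedKernel r p z n j)
      + (logDer r p z n j - logDer r p z n i) * gaugedKernel r p z i j := by
  have a1 := gaugedKernel_mul (p := p) h.isUnit_two (h.isUnit_r i) (h.isUnit_sub i j hij)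
  have a2 := gaugedKernel_mul (p := p) h.isUnit_two (h.isUnit_r i) (h.isUnit_sub i n hi)
  have a3 := gaugedKernel_mul (p := p) h.isUnit_two (h.isUnit_r n) (h.isUnit_sub n j hj.symm)
  have a4 := logDer_mul (p := p) h.isUnit_two (h.isUnit_r j) (h.isUnit_sub j n hj)
  have a5 := logDer_mul (p := p) h.isUnit_two (h.isUnit_r i) (h.isUnit_sub i n hi)
  have d0 := congrArg D a1
  have hD2 : D 2 = 0 := by simpa using D.map_natCast 2
  simp only [map_sub, map_add, Derivation.leibniz, Derivation.leibniz_pow, smul_eq_mul,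
    nsmul_eq_mul, hD.z_eq, hD2, mul_zero, sub_zero, add_zero] at d0
  have core := insertion_polynomial_identity (h.eq i) (h.eq j) (h.eq n)
  have ri := hD.r_eq i hi
  have rj := hD.r_eq j hj
  have pi := hD.p_eq i hi
  have pj := hD.p_eq j hj
  set e := gaugedKernel r p z i j
  set e1 := gaugedKernel r p z i n
  set e2 := gaugedKernel r p z n j
  set gj := logDer r p z n j
  set gi := logDer r p z n i
  -- A common denominator of all kernels, logarithmic derivatives and `D`-derivatives involved.
  -- After multiplication by it, only `insertion_polynomial_identity` remains.
  have hu : IsUnit (2 * 2 * ((z j ^ 2 - z i ^ 2) * r i * r i * (z n ^ 2 - z i ^ 2)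
      * (z j ^ 2 - z n ^ 2) * r n * r j)) :=
    (h.isUnit_two.mul h.isUnit_two).mul ((((((h.isUnit_sub i j hij).mul (h.isUnit_r i)).mul
      (h.isUnit_r i)).mul (h.isUnit_sub i n hi)).mul (h.isUnit_sub n j hj.symm)).mul
      (h.isUnit_r n) |>.mul (h.isUnit_r j))
  apply hu.mul_left_cancel
  set A := z j ^ 2 - z i ^ 2
  set B := z n ^ 2 - z i ^ 2 with hB
  set C := z j ^ 2 - z n ^ 2 with hC
  have hB' : z i ^ 2 - z n ^ 2 = - B := by rw [hB]; ring
  have hC' : z n ^ 2 - z j ^ 2 = - C := by rw [hC]; ring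
  rw [hB'] at ri pi
  rw [hC'] at a4
  set N := r i * (p j - 2 * z j) - r j * (p i + 2 * z i)
  linear_combination core + 2 * (r i * B * C * r n * r j) * d0
    + (-2 * D (r i) * B * C * r n * r j - 2 * (gj - gi) * r i * B * C * r n * r j) * a1
    + (A * r i * r j * 2 * e2 * C * r n) * a2
    + (A * r i * r j * (r i * (p n - 2 * z n) - r n * (p i + 2 * z i))) * a3
    + (N * r n * r i * B) * a4
    + (N * r n * r j * C) * a5
    - 2 * r n * r j * (r i * (p j - 2 * z j) * C - N * C) * ri
    - 2 * r n * r j * r i * B * (p i + 2 * z i) * rj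
    + 2 * r n * r j * r i * r i * B * pj
    + 2 * r n * r j * r i * r j * C * pi

end Kernel

/-! ### Products along chains and cycles -/

section Chains

variable {S ι : Type*} [CommRing S]

/-- The product of `e` over the consecutive pairs of `x, l, y`. -/
def chainProd (e : ι → ι → S) (x : ι) : List ι → ι → S
  | [], y => e x y
  | a :: l, y => e x a * chainProd e a l y

/-- The sum of the products of `e` over all cycles through `x` and the elements of `l`. -/
def cycleSum (e : ι → ι → S) (x : ι) (l : List ι) : S :=
  ((l.permutations').map fun l' => chainProd e x l' x).sum

/-- By the Leibniz rule each edge in turn is replaced by two edges through `n`, and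
`permutations'Aux n l` lists exactly these insertions. The differences of `g` along the chain
telescope. -/
theorem derivation_chainProd {e : ι → ι → S} {g : ι → S} {D : Derivation ℤ S S} {n : ι}
    (hD : ∀ i j, i ≠ j → i ≠ n → j ≠ n →
      D (e i j) = -(e i n * e n j) + (g j - g i) * e i j)
    (l : List ι) (x y : ι) (hc : List.IsChain (· ≠ ·) (x :: (l ++ [y])))
    (hn : n ∉ x :: (l ++ [y])) :
    D (chainProd e x l y) =
      -((l.permutations'Aux n).map fun l' => chainProd e x l' y).sum
        + (g y - g x) * chainProd e x l y := by
  induction l generalizing x with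
  | nil =>
    simp only [List.nil_append, List.isChain_cons_cons] at hc
    simp only [List.nil_append, List.mem_cons, not_or] at hn
    simp [chainProd, hD x y hc.1 (Ne.symm hn.1) (Ne.symm hn.2.1)]
  | cons a l ih =>
    simp only [List.cons_append, List.isChain_cons_cons] at hc
    simp only [List.cons_append, List.mem_cons, not_or] at hn
    have h1 := ih a hc.2 (by simpa using hn.2)
    have h2 := hD x a hc.1 (Ne.symm hn.1) (Ne.symm hn.2.1)
    rw [chainProd, Derivation.leibniz, h1, h2, List.permutations'Aux]
    simp only [List.map_cons, List.sum_cons, List.map_map, Function.comp_def, chainProd,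
      smul_eq_mul, List.sum_map_mul_left]
    ring

theorem derivation_sum_flatMap {α : Type*} {D : Derivation ℤ S S} {f : α → S} {F : α → List α}
    {L : List α} (h : ∀ a ∈ L, D (f a) = -((F a).map f).sum) :
    D (L.map f).sum = -((L.flatMap F).map f).sum := by
  induction L with
  | nil => simp
  | cons a L ih =>
    rw [List.map_cons, List.sum_cons, map_add, h a (by simp),
      ih fun b hb => h b (List.mem_cons_of_mem _ hb), List.flatMap_cons, List.map_append,
      List.sum_append]
    ring

/-- On a closed chain the telescoped term is zero, and `permutations' (n :: l)` is by definition
made of the insertions of `n` into the permutations of `l`. For `l = []` the only edge would be a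
loop at `x`, where the rule for `e` says nothing. -/
theorem derivation_cycleSum {e : ι → ι → S} {g : ι → S} {D : Derivation ℤ S S} {n : ι}
    (hD : ∀ i j, i ≠ j → i ≠ n → j ≠ n →
      D (e i j) = -(e i n * e n j) + (g j - g i) * e i j)
    {l : List ι} {x : ι} (hl : l ≠ []) (hx : (x :: l).Nodup) (hn : n ∉ x :: l) :
    D (cycleSum e x l) = - cycleSum e x (n :: l) := by
  rw [cycleSum, cycleSum, List.permutations']
  refine derivation_sum_flatMap fun l' hl' => ?_
  have hp : l'.Perm l := List.mem_permutations'.1 hl'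
  have hne : l' ≠ [] := fun h => hl (by rw [h] at hp; exact hp.symm.eq_nil)
  have hnd : (x :: l').Nodup := (hp.cons x).nodup_iff.2 hx
  have hmem : n ∉ x :: l' := fun h => hn ((hp.cons x).mem_iff.1 h)
  rw [derivation_chainProd hD]
  · simp
  · obtain ⟨a, l'', rfl⟩ := List.exists_cons_of_ne_nil hne
    rw [List.cons_append, List.isChain_cons_cons]
    refine ⟨fun h => ?_, ?_⟩
    · simp [h] at hnd
    · exact List.Pairwise.isChain (((List.perm_append_singleton x (a :: l'')).nodup_iff).2 hnd)
  · simp only [List.mem_cons, List.mem_append, not_or] at hmem ⊢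
    simp [hmem.1, hmem.2]

end Chains

/-! ### Cyclic orders and cycles through a fixed element -/

section CyclicOrders

variable {S : Type*} [CommRing S]

/-- The permutation with `0 ↦ last` and `i + 1 ↦ σ i`. -/
def lastPerm {n : ℕ} (σ : Equiv.Perm (Fin n)) : Equiv.Perm (Fin (n + 1)) :=
  (finRotate (n + 1))⁻¹ * Equiv.Perm.decomposeFin.symm (0, σ)

theorem lastPerm_zero {n : ℕ} (σ : Equiv.Perm (Fin n)) : lastPerm σ 0 = Fin.last n := by
  rw [lastPerm, Equiv.Perm.mul_apply, Equiv.Perm.decomposeFin_symm_apply_zero,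
    Equiv.Perm.inv_eq_iff_eq, finRotate_last]

theorem lastPerm_succ {n : ℕ} (σ : Equiv.Perm (Fin n)) (i : Fin n) :
    lastPerm σ i.succ = (σ i).castSucc := by
  rw [lastPerm, Equiv.Perm.mul_apply, Equiv.Perm.decomposeFin_symm_apply_succ,
    Equiv.swap_self, Equiv.refl_apply, Equiv.Perm.inv_eq_iff_eq, finRotate_apply]
  simp

theorem exists_lastPerm {n : ℕ} {τ : Equiv.Perm (Fin (n + 1))} (h : τ 0 = Fin.last n) :
    ∃ σ, lastPerm σ = τ := by
  refine ⟨(Equiv.Perm.decomposeFin (finRotate (n + 1) * τ)).2, ?_⟩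
  have h1 : (Equiv.Perm.decomposeFin (finRotate (n + 1) * τ)).1 = 0 := by
    have h2 := Equiv.Perm.decomposeFin_symm_apply_zero
      (Equiv.Perm.decomposeFin (finRotate (n + 1) * τ)).1
      (Equiv.Perm.decomposeFin (finRotate (n + 1) * τ)).2
    rw [Prod.mk.eta, Equiv.symm_apply_apply, Equiv.Perm.mul_apply, h, finRotate_last] at h2
    exact h2.symm
  rw [lastPerm, ← h1, Prod.mk.eta, Equiv.symm_apply_apply, inv_mul_cancel_left]

theorem lastPerm_injective {n : ℕ} : Function.Injective (lastPerm (n := n)) := by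
  intro σ τ h
  have h1 := Equiv.Perm.decomposeFin.symm.injective (mul_left_cancel h)
  exact (Prod.mk.inj h1).2

theorem finRotate_pow_zero {n : ℕ} (k : ℕ) :
    ((finRotate (n + 1) ^ k) 0 : Fin (n + 1)).val = k % (n + 1) := by
  induction k with
  | zero => simp
  | succ k ih =>
    rw [pow_succ', Equiv.Perm.mul_apply, finRotate_apply, Fin.val_add, ih, Fin.val_one',
      ← Nat.add_mod]

theorem finRotate_pow_val {n : ℕ} (i : Fin (n + 1)) :
    (finRotate (n + 1) ^ (i : ℕ)) 0 = i := by
  ext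
  rw [finRotate_pow_zero, Nat.mod_eq_of_lt i.isLt]

theorem finRotate_pow_card (n : ℕ) : finRotate (n + 1) ^ (n + 1) = 1 := by
  ext1 i
  have h0 : (finRotate (n + 1) ^ (n + 1)) 0 = 0 := by
    ext
    rw [finRotate_pow_zero, Nat.mod_self, Fin.val_zero]
  have hc : (finRotate (n + 1) ^ (n + 1)) ((finRotate (n + 1) ^ (i : ℕ)) 0) =
      (finRotate (n + 1) ^ (i : ℕ)) ((finRotate (n + 1) ^ (n + 1)) 0) := by
    rw [← Equiv.Perm.mul_apply, ← Equiv.Perm.mul_apply, ← pow_add, ← pow_add,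
      Nat.add_comm (n + 1) (i : ℕ)]
  rwa [h0, finRotate_pow_val] at hc

theorem finRotate_zpow_eq_one {n : ℕ} {m : ℤ} (h : (finRotate (n + 1) ^ m) 0 = 0) :
    finRotate (n + 1) ^ m = 1 := by
  have hpos : (0 : ℤ) < (n + 1 : ℕ) := by positivity
  have h1 : finRotate (n + 1) ^ m = finRotate (n + 1) ^ (m % (n + 1 : ℕ)).toNat := by
    rw [← zpow_natCast, Int.toNat_of_nonneg (Int.emod_nonneg _ hpos.ne')]
    conv_lhs => rw [← Int.emod_add_mul_ediv m (n + 1 : ℕ), zpow_add, zpow_mul, zpow_natCast,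
      finRotate_pow_card, one_zpow, mul_one]
  have h2 : (m % (n + 1 : ℕ)).toNat < n + 1 := by
    have := Int.emod_lt_of_pos m hpos
    omega
  have h3 : (m % (n + 1 : ℕ)).toNat = 0 := by
    have h4 := congrArg Fin.val h
    rwa [h1, finRotate_pow_zero, Nat.mod_eq_of_lt h2] at h4
  rw [h1, h3, pow_zero]

/-- Each cyclic order has exactly one representative that starts at the last element: a rotation
brings that element to position `0`, and a rotation fixing `0` is trivial. -/
theorem lastPerm_bijective (n : ℕ) :
    Function.Bijective fun σ : Equiv.Perm (Fin n) =>
      (QuotientGroup.mk (lastPerm σ) : CyclicOrders (n + 1)) := by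
  constructor
  · intro σ τ h
    obtain ⟨m, hm⟩ := Subgroup.mem_zpowers_iff.1 (QuotientGroup.eq.1 h)
    have h1 : lastPerm τ = lastPerm σ * finRotate (n + 1) ^ m := by rw [hm, mul_inv_cancel_left]
    have h2 : finRotate (n + 1) ^ m = 1 := by
      apply finRotate_zpow_eq_one
      apply (lastPerm σ).injective
      rw [← Equiv.Perm.mul_apply, ← h1, lastPerm_zero, lastPerm_zero]
    rw [h2, mul_one] at h1
    exact lastPerm_injective h1.symm
  · intro Q
    induction Q using QuotientGroup.induction_on with
    | H τ =>
      set k := (τ⁻¹ (Fin.last n) : Fin (n + 1)) with hk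
      obtain ⟨σ, hσ⟩ := exists_lastPerm (τ := τ * finRotate (n + 1) ^ (k : ℕ)) (by
        rw [Equiv.Perm.mul_apply, finRotate_pow_val, hk,
          Equiv.Perm.inv_def, Equiv.apply_symm_apply])
      refine ⟨σ, ?_⟩
      change QuotientGroup.mk (lastPerm σ) = QuotientGroup.mk τ
      rw [hσ]
      exact (QuotientGroup.eq.2 (Subgroup.mem_zpowers_iff.2 ⟨(k : ℕ), by simp⟩)).symm

theorem chainProd_ofFn {ι : Type*} (e : ι → ι → S) {n : ℕ} (f : Fin (n + 1) → ι) (y : ι) :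
    chainProd e (f 0) (List.ofFn fun i : Fin n => f i.succ) y =
      (∏ i : Fin n, e (f i.castSucc) (f i.succ)) * e (f (Fin.last n)) y := by
  induction n with
  | zero => simp [chainProd]
  | succ n ih =>
    rw [List.ofFn_succ, chainProd, Fin.prod_univ_succ, ih fun i => f i.succ]
    simp [mul_assoc]

theorem cyclicProd_eq_chainProd {n : ℕ} (e : Fin (n + 1) → Fin (n + 1) → S)
    (σ : Equiv.Perm (Fin (n + 1))) :
    cyclicProd e σ = chainProd e (σ 0) (List.ofFn fun i : Fin n => σ i.succ) (σ 0) := by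
  rw [chainProd_ofFn, cyclicProd, Fin.prod_univ_castSucc, finRotate_last]
  congr 1
  refine Finset.prod_congr rfl fun i _ => ?_
  rw [finRotate_apply, Fin.coeSucc_eq_succ]

/-- With the representatives `lastPerm σ`, a cyclic order becomes a cycle based at the last point,
and the other points are visited in the order of an arbitrary permutation `σ`. -/
theorem cyclicSum_eq_cycleSum {n : ℕ} (e : Fin (n + 1) → Fin (n + 1) → S) :
    cyclicSum e = cycleSum e (Fin.last n) ((List.finRange n).map Fin.castSucc) := by
  rw [cyclicSum, ← finsum_comp_equiv (Equiv.ofBijective _ (lastPerm_bijective n)),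
    finsum_eq_sum_of_fintype, cycleSum, ← List.map_permutations', List.map_map]
  have hnd : (List.permutations' (List.finRange n)).Nodup :=
    (List.permutations_perm_permutations' _).nodup_iff.1
      (List.nodup_permutations _ (List.nodup_finRange n))
  rw [← List.sum_toFinset _ hnd]
  refine Finset.sum_bij (fun σ _ => List.ofFn σ) ?_ ?_ ?_ ?_
  · intro σ _
    rw [List.mem_toFinset, List.mem_permutations', List.ofFn_eq_map]
    exact (List.perm_ext_iff_of_nodup ((List.nodup_finRange n).map σ.injective)
      (List.nodup_finRange n)).2 fun i => by
        simp only [List.mem_finRange, iff_true, List.mem_map, true_and]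
        exact σ.surjective i
  · intro σ _ τ _ h
    exact Equiv.ext fun i => congrFun (List.ofFn_injective h) i
  · intro l hl
    rw [List.mem_toFinset, List.mem_permutations'] at hl
    have hlen : l.length = n := by rw [hl.length_eq, List.length_finRange]
    have hlnd : l.Nodup := hl.nodup_iff.2 (List.nodup_finRange _)
    refine ⟨Equiv.ofBijective (fun i => l.get (Fin.cast hlen.symm i))
      (Finite.injective_iff_bijective.1 fun i j hij =>
        Fin.cast_injective _ (List.nodup_iff_injective_get.1 hlnd hij)), Finset.mem_univ _, ?_⟩
    exact List.ext_getElem (by simp [hlen]) fun i h1 h2 => by simp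
  · intro σ _
    change cyclicProd e (lastPerm σ) = _
    rw [cyclicProd_eq_chainProd, lastPerm_zero]
    simp only [lastPerm_succ, Function.comp_apply, List.map_ofFn]
    rfl

end CyclicOrders

/-! ### Resolvents and correlation functions in several spectral variables -/

section Spectral

variable {W : Type*} [CommRing W] [Algebra ℚ W] {δ : Derivation ℚ W W} {u : TimeSeries W}
  {ι S : Type*} [CommRing S] {φ : MvPowerSeries ι (TimeSeries W) →+* S} {z : ι → S}

/-- A ring over the series in the `1 / z_i` that contains the `z_i` and `1 / (z_j^2 - z_i^2)`, and
to which the generating derivations extend. -/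
structure IsSpectral (δ : Derivation ℚ W W) (φ : MvPowerSeries ι (TimeSeries W) →+* S)
    (z : ι → S) : Prop where
  mul_X : ∀ i, z i * φ (MvPowerSeries.X i) = 1
  isUnit_sub : ∀ i j, i ≠ j → IsUnit (z j ^ 2 - z i ^ 2)
  exists_der : ∀ k, ∃ D : Derivation ℤ S S, ∀ f, D (φ f) = φ (vertexDer (timeDer δ) k f)

/-- The resolvent series at `z_j`. -/
def specRes (φ : MvPowerSeries ι (TimeSeries W) →+* S) (δ : Derivation ℚ W W) (u : TimeSeries W)
    (j : ι) : S :=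
  φ (resSeries (resValue δ u) j)

/-- The `x`-derivative of the resolvent series at `z_j`. -/
def specResDer (φ : MvPowerSeries ι (TimeSeries W) →+* S) (δ : Derivation ℚ W W)
    (u : TimeSeries W) (j : ι) : S :=
  φ (coeffDer ι (xDer δ) (resSeries (resValue δ u) j))

/-- The second `x`-derivative of the resolvent series at `z_j`. -/
def specResDerDer (φ : MvPowerSeries ι (TimeSeries W) →+* S) (δ : Derivation ℚ W W)
    (u : TimeSeries W) (j : ι) : S :=
  φ (coeffDer ι (xDer δ) (coeffDer ι (xDer δ) (resSeries (resValue δ u) j)))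

theorem IsSolution.resolventSystem (hu : IsSolution δ u) (hφ : IsSpectral δ φ z) :
    ResolventSystem (specRes φ δ u) (specResDer φ δ u) (specResDerDer φ δ u) z
      (φ (MvPowerSeries.C u)) where
  isUnit_two := by
    have h := (isUnit_two (A := MvPowerSeries ι (TimeSeries W))).map φ
    rwa [map_ofNat] at h
  isUnit_r i := (hu.isKdVFlow.isUnit_resSeries i).map φ
  isUnit_sub := hφ.isUnit_sub
  eq i := by
    have h1 := congrArg φ (hu.isKdVFlow.resolventEq i)
    simp only [map_sub, map_mul, map_add, map_pow, map_neg, map_ofNat] at h1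
    change φ (MvPowerSeries.X i) ^ 2 * (2 * (specRes φ δ u i * specResDerDer φ δ u i)
      - specResDer φ δ u i ^ 2 + 8 * φ (MvPowerSeries.C u) * specRes φ δ u i ^ 2)
      - 4 * specRes φ δ u i ^ 2 = -4 at h1
    have hX := hφ.mul_X i
    linear_combination z i ^ 2 * h1 - (2 * (specRes φ δ u i * specResDerDer φ δ u i)
      - specResDer φ δ u i ^ 2 + 8 * φ (MvPowerSeries.C u) * specRes φ δ u i ^ 2) *
        (z i * φ (MvPowerSeries.X i) + 1) * hX

theorem IsSpectral.derivation_z (hφ : IsSpectral δ φ z) {k : ι} {D : Derivation ℤ S S}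
    (hD : ∀ f, D (φ f) = φ (vertexDer (timeDer δ) k f)) (i : ι) : D (z i) = 0 := by
  have hX := hφ.mul_X i
  have h := congrArg D hX
  rw [Derivation.leibniz, hD, vertexDer_X, map_zero, smul_zero, zero_add,
    Derivation.map_one_eq_zero, smul_eq_mul] at h
  linear_combination z i * h - D (z i) * hX

/-- The evolution of the resolvent, multiplied by `z_i² z_k²` to turn `X_k² - X_i²` into `z_i² -
z_k²`. For `p_eq` it is first differentiated in `x`, where the products of two first derivatives
cancel. -/
theorem IsSolution.isInsertion (hu : IsSolution δ u) (hφ : IsSpectral δ φ z) (k : ι)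
    {D : Derivation ℤ S S} (hD : ∀ f, D (φ f) = φ (vertexDer (timeDer δ) k f)) :
    IsInsertion (specRes φ δ u) (specResDer φ δ u) (specResDerDer φ δ u) z D k where
  z_eq := hφ.derivation_z hD
  r_eq i _ := by
    have h := congrArg φ (hu.isKdVFlow.vertexDer_resSeries k i)
    simp only [map_sub, map_mul, map_pow, ← hD] at h
    change (_ ^ 2 - _ ^ 2) * D (specRes φ δ u i) = _ ^ 2 * _ ^ 2 *
      (specRes φ δ u i * specResDer φ δ u k - specRes φ δ u k * specResDer φ δ u i) at h
    have hi := hφ.mul_X i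
    have hk := hφ.mul_X k
    set x := φ (MvPowerSeries.X i)
    set y := φ (MvPowerSeries.X k)
    have hi2 : z i ^ 2 * x ^ 2 = 1 := by rw [← mul_pow, hi, one_pow]
    have hk2 : z k ^ 2 * y ^ 2 = 1 := by rw [← mul_pow, hk, one_pow]
    linear_combination z i ^ 2 * z k ^ 2 * h
      + (z k ^ 2 * D (specRes φ δ u i) + (specRes φ δ u i * specResDer φ δ u k
        - specRes φ δ u k * specResDer φ δ u i) * (z k * y) ^ 2) * hi2
      + (-z i ^ 2 * D (specRes φ δ u i) + (specRes φ δ u i * specResDer φ δ u k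
        - specRes φ δ u k * specResDer φ δ u i)) * hk2
  p_eq i _ := by
    have h := congrArg (coeffDer ι (timeDer δ 0)) (hu.isKdVFlow.vertexDer_resSeries k i)
    simp only [Derivation.leibniz, Derivation.leibniz_pow, map_sub, coeffDer_X, smul_eq_mul,
      nsmul_eq_mul, mul_zero, sub_zero, add_zero,
      ← vertexDer_coeffDer hu.isKdVFlow.comm] at h
    replace h := congrArg φ h
    simp only [map_sub, map_mul, map_add, map_pow, ← hD] at h
    change (_ ^ 2 - _ ^ 2) * D (specResDer φ δ u i) = _ ^ 2 * _ ^ 2 *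
      (specRes φ δ u i * specResDerDer φ δ u k + specResDer φ δ u k * specResDer φ δ u i
       - (specRes φ δ u k * specResDerDer φ δ u i + specResDer φ δ u i * specResDer φ δ u k)) at h
    have hi := hφ.mul_X i
    have hk := hφ.mul_X k
    set x := φ (MvPowerSeries.X i)
    set y := φ (MvPowerSeries.X k)
    have hi2 : z i ^ 2 * x ^ 2 = 1 := by rw [← mul_pow, hi, one_pow]
    have hk2 : z k ^ 2 * y ^ 2 = 1 := by rw [← mul_pow, hk, one_pow]
    linear_combination z i ^ 2 * z k ^ 2 * h
      + (z k ^ 2 * D (specResDer φ δ u i) + (specRes φ δ u i * specResDerDer φ δ u k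
        - specRes φ δ u k * specResDerDer φ δ u i) * (z k * y) ^ 2) * hi2
      + (-z i ^ 2 * D (specResDer φ δ u i) + (specRes φ δ u i * specResDerDer φ δ u k
        - specRes φ δ u k * specResDerDer φ δ u i)) * hk2

theorem map_evalAt_resSeries {σ : Type*} (j : σ) :
    MvPowerSeries.map (evalAt δ u).toRingHom (resSeries resolventCoeff j) =
      resSeries (resValue δ u) j := by
  classical
  ext1 e
  rw [MvPowerSeries.coeff_map, resSeries, resSeries, coeff_varSeries, coeff_varSeries]
  split_ifs
  · rfl
  · exact map_zero _

theorem map_evalAt_coeffDer {σ : Type*} (f : MvPowerSeries σ DiffPoly) :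
    MvPowerSeries.map (evalAt δ u).toRingHom (coeffDer σ dPoly f) =
      coeffDer σ (xDer δ) (MvPowerSeries.map (evalAt δ u).toRingHom f) := by
  ext1 e
  exact evalAt_dPoly _

/-- The generating series of the correlation functions in the spectral variables of a list. -/
def specCorr (φ : MvPowerSeries ι (TimeSeries W) →+* S) (δ : Derivation ℚ W W) (u : TimeSeries W)
    (Ω : ℕ → ℕ → DiffPoly) (l : List ι) : S :=
  φ (corrSeries (fun ps => evalAt δ u (multiOmega Ω ps)) l)

variable {Ω : ℕ → ℕ → DiffPoly}

theorem IsCanonicalTauStructure.specCorr_pair (hΩ : IsCanonicalTauStructure Ω)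
    (hφ : IsSpectral δ φ z) {i j : ι} (hij : i ≠ j) :
    2 * (z j ^ 2 - z i ^ 2) ^ 2 * specCorr φ δ u Ω [i, j] =
      specResDer φ δ u i * specResDer φ δ u j
        - specRes φ δ u i * (specResDerDer φ δ u j
          - 2 * (z j ^ 2 - 2 * φ (MvPowerSeries.C u)) * specRes φ δ u j)
        - specRes φ δ u j * (specResDerDer φ δ u i
          - 2 * (z i ^ 2 - 2 * φ (MvPowerSeries.C u)) * specRes φ δ u i)
        - 2 * z i ^ 2 - 2 * z j ^ 2 := by
  have h := congrArg (fun f => φ (MvPowerSeries.map (evalAt δ u).toRingHom f))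
    (hΩ.twoPoint hij rfl rfl rfl rfl rfl rfl)
  have hC : MvPowerSeries.map (evalAt δ u).toRingHom
      (MvPowerSeries.C (uVar 0) : MvPowerSeries ι DiffPoly) = MvPowerSeries.C u := by
    rw [MvPowerSeries.map_C]
    congr 1
    exact MvPolynomial.aeval_X _ 0
  simp only [map_sub, map_mul, map_pow, map_ofNat, map_one, map_evalAt_coeffDer,
    map_evalAt_resSeries, map_corrSeries, MvPowerSeries.map_X, hC] at h
  have hi := hφ.mul_X i
  have hj := hφ.mul_X j
  set x := φ (MvPowerSeries.X i)
  set y := φ (MvPowerSeries.X j)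
  set U := φ (MvPowerSeries.C u)
  change 2 * (x ^ 2 - y ^ 2) ^ 2 * specCorr φ δ u Ω [i, j] = x ^ 2 * y ^ 2 * (x ^ 2 * y ^ 2 *
      specResDer φ δ u i * specResDer φ δ u j - specRes φ δ u i * x ^ 2 *
        (y ^ 2 * specResDerDer φ δ u j - 2 * (1 - 2 * U * y ^ 2) * specRes φ δ u j)
      - specRes φ δ u j * y ^ 2 * (x ^ 2 * specResDerDer φ δ u i
        - 2 * (1 - 2 * U * x ^ 2) * specRes φ δ u i) - 2 * x ^ 2 - 2 * y ^ 2) at h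
  have hx : IsUnit x := .of_mul_eq_one_right _ hi
  have hy : IsUnit y := .of_mul_eq_one_right _ hj
  have hi2 : z i ^ 2 * x ^ 2 = 1 := by rw [← mul_pow, hi, one_pow]
  have hj2 : z j ^ 2 * y ^ 2 = 1 := by rw [← mul_pow, hj, one_pow]
  have h1 : (z j ^ 2 - z i ^ 2) * (x ^ 2 * y ^ 2) = x ^ 2 - y ^ 2 := by
    linear_combination x ^ 2 * hj2 - y ^ 2 * hi2
  apply ((hx.pow 2).mul (hy.pow 2)).pow 2 |>.mul_left_cancel
  rw [← h1] at h
  linear_combination h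
    - (2 * specRes φ δ u i * specRes φ δ u j - 2) * x ^ 4 * y ^ 2 * hj2
    - (2 * specRes φ δ u i * specRes φ δ u j - 2) * x ^ 2 * y ^ 4 * hi2

/-- The two-point function in terms of the kernel. -/
theorem IsCanonicalTauStructure.specCorr_pair_eq (hΩ : IsCanonicalTauStructure Ω)
    (hu : IsSolution δ u) (hφ : IsSpectral δ φ z) {x y : ι} (hyx : y ≠ x) :
    specCorr φ δ u Ω [y, x] =
      -(gaugedKernel (specRes φ δ u) (specResDer φ δ u) z x y *
          gaugedKernel (specRes φ δ u) (specResDer φ δ u) z y x)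
        - Ring.inverse ((z y - z x) ^ 2) := by
  have h := hu.resolventSystem hφ
  have hG := hΩ.specCorr_pair (u := u) hφ hyx
  have a1 := gaugedKernel_mul (p := specResDer φ δ u) h.isUnit_two (h.isUnit_r x)
    (h.isUnit_sub x y hyx.symm)
  have a2 := gaugedKernel_mul (p := specResDer φ δ u) h.isUnit_two (h.isUnit_r y)
    (h.isUnit_sub y x hyx)
  have hx := h.eq x
  have hy := h.eq y
  have hf : z y ^ 2 - z x ^ 2 = (z y - z x) * (z y + z x) := by ring
  have hd : IsUnit (z y - z x) :=
    isUnit_of_mul_isUnit_left (hf ▸ h.isUnit_sub x y hyx.symm)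
  have hI := Ring.mul_inverse_cancel _ (hd.pow 2)
  have hu4 : IsUnit (2 * 2 * ((z x ^ 2 - z y ^ 2) ^ 2 * (specRes φ δ u x * specRes φ δ u y))) :=
    (h.isUnit_two.mul h.isUnit_two).mul (((h.isUnit_sub y x hyx).pow 2).mul
      ((h.isUnit_r x).mul (h.isUnit_r y)))
  apply hu4.mul_left_cancel
  set e := gaugedKernel (specRes φ δ u) (specResDer φ δ u) z x y
  set e' := gaugedKernel (specRes φ δ u) (specResDer φ δ u) z y x
  set rx := specRes φ δ u x
  set ry := specRes φ δ u y
  set px := specResDer φ δ u x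
  set py := specResDer φ δ u y
  -- The resolvent equations at `x` and `y` eliminate the squares of the first derivatives from the
  -- product of the two kernels. The remainder `(z x + z y) ^ 2`, over `(z x ^ 2 - z y ^ 2) ^ 2`, is
  -- the correction `1 / (z y - z x) ^ 2`.
  linear_combination 2 * rx * ry * hG - rx ^ 2 * hy - ry ^ 2 * hx
    + 4 * (z x + z y) ^ 2 * rx * ry * hI
    - 2 * e' * (z x ^ 2 - z y ^ 2) * ry * a1 - (rx * (py - 2 * z y) - ry * (px + 2 * z x)) * a2

theorem derivation_inverse_eq_zero {D : Derivation ℤ S S} {f : S} (hf : IsUnit f)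
    (h : D f = 0) : D (Ring.inverse f) = 0 := by
  have h1 := Ring.mul_inverse_cancel _ hf
  have h2 := congrArg D h1
  rw [Derivation.leibniz, h, smul_zero, add_zero, Derivation.map_one_eq_zero, smul_eq_mul] at h2
  linear_combination Ring.inverse f * h2 - D (Ring.inverse f) * h1

/-- Along a solution `D_p` becomes `∂/∂t_p`, so the recursion of `multiOmega` is the insertion rule;
that recursion starts at two points. -/
theorem IsSolution.derivation_specCorr (hu : IsSolution δ u) {k : ι} {D : Derivation ℤ S S}
    (hD : ∀ f, D (φ f) = φ (vertexDer (timeDer δ) k f)) {l : List ι} (hk : k ∉ l)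
    (hl : 2 ≤ l.length) : D (specCorr φ δ u Ω l) = specCorr φ δ u Ω (k :: l) := by
  rw [specCorr, specCorr, hD, vertexDer_corrSeries _ _ hk]
  intro p ps hps
  rw [multiOmega_cons Ω p (hps ▸ hl), hu.evalAt_kdvDer]

/-- The correlation functions as sums over cycles. -/
theorem IsCanonicalTauStructure.specCorr_eq_cycleSum (hΩ : IsCanonicalTauStructure Ω)
    (hu : IsSolution δ u) (hφ : IsSpectral δ φ z) (l : List ι) {x y : ι}
    (hl : (l ++ [y, x]).Nodup) :
    specCorr φ δ u Ω (l ++ [y, x]) =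
      (-1) ^ (l.length + 1) *
          cycleSum (gaugedKernel (specRes φ δ u) (specResDer φ δ u) z) x (l ++ [y])
        - if l = [] then Ring.inverse ((z y - z x) ^ 2) else 0 := by
  induction l with
  | nil =>
    have hyx : y ≠ x := by simpa using hl
    rw [List.nil_append, hΩ.specCorr_pair_eq hu hφ hyx]
    simp [cycleSum, chainProd, List.permutations']
  | cons k l ih =>
    obtain ⟨D, hD⟩ := hφ.exists_der k
    rw [List.cons_append, List.nodup_cons] at hl
    have hyx : y ≠ x := by
      have := (List.nodup_append.1 hl.2).2.1
      simpa using this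
    have hfix := hφ.derivation_z hD
    have hf : z y ^ 2 - z x ^ 2 = (z y - z x) * (z y + z x) := by ring
    have hd : IsUnit (z y - z x) :=
      isUnit_of_mul_isUnit_left (hf ▸ hφ.isUnit_sub x y hyx.symm)
    -- The two-point correction does not depend on the times, so the first insertion removes it for
    -- all `n ≥ 3`.
    have h0 : D (Ring.inverse ((z y - z x) ^ 2)) = 0 :=
      derivation_inverse_eq_zero (hd.pow 2) (by
        rw [Derivation.leibniz_pow, map_sub, hfix, hfix, sub_zero, smul_zero, smul_zero])
    have hperm : (l ++ [y, x]).Perm (x :: (l ++ [y])) := by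
      rw [show l ++ [y, x] = (l ++ [y]) ++ [x] by simp]
      exact List.perm_append_singleton _ _
    have hc := derivation_cycleSum
      (e := gaugedKernel (specRes φ δ u) (specResDer φ δ u) z)
      (g := logDer (specRes φ δ u) (specResDer φ δ u) z k)
      (fun i j hij hi hj => (hu.resolventSystem hφ).insertion_gaugedKernel
        (hu.isInsertion hφ k hD) hij hi hj)
      (l := l ++ [y]) (x := x) (by simp) (hperm.nodup_iff.1 hl.2)
      (fun h => hl.1 (hperm.mem_iff.2 h))
    have hs : D ((-1) ^ (l.length + 1)) = 0 := by
      rw [Derivation.leibniz_pow, map_neg, Derivation.map_one_eq_zero, neg_zero, smul_zero,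
        smul_zero]
    rw [List.cons_append, ← hu.derivation_specCorr hD hl.1 (by simp), ih hl.2, map_sub,
      Derivation.leibniz, hc, hs, if_neg (List.cons_ne_nil _ _), List.length_cons]
    have h1 : D (if l = [] then Ring.inverse ((z y - z x) ^ 2) else 0) = 0 := by
      split_ifs
      · exact h0
      · exact map_zero D
    rw [h1, smul_zero, smul_eq_mul, List.cons_append]
    ring

end Spectral

/-! ### Cyclic products of wave functions -/

section KernelFactor

variable {S : Type*} [CommRing S] {n : ℕ}

/-- Sum and difference of `hsum` and `hsub` give `2 A B' = p - 2z` and `2 A' B = p + 2z`. After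
multiplication by `B i * A j` the kernel involves only such products. -/
theorem inverse_mul_eq_gaugedKernel {ι : Type*} {A B A' B' r p z : ι → S}
    (hAB : ∀ i, A i * B i = r i)
    (hsum : ∀ i, A i * B' i + A' i * B i = p i) (hsub : ∀ i, A i * B' i - A' i * B i = -2 * z i)
    {i j : ι} (h2 : IsUnit (2 : S)) (hr : IsUnit (r i)) (hz : IsUnit (z j ^ 2 - z i ^ 2)) :
    Ring.inverse (z j ^ 2 - z i ^ 2) * (A i * B' j - B j * A' i) * (B i * A j) =
      gaugedKernel r p z i j * r i := by
  have h := gaugedKernel_mul (p := p) h2 hr hz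
  have hI := Ring.mul_inverse_cancel _ hz
  apply (h2.mul hz).mul_left_cancel
  set Λ := z j ^ 2 - z i ^ 2
  linear_combination -h + 2 * (A i * B' j - B j * A' i) * (B i * A j) * hI
    + 2 * A j * B' j * hAB i - 2 * A' i * B i * hAB j + r i * (hsum j + hsub j)
    - r j * (hsum i - hsub i)

theorem finRotate_apply_ne (hn : 2 ≤ n) (i : Fin n) : finRotate n i ≠ i := by
  obtain ⟨n, rfl⟩ := Nat.exists_eq_add_of_le' hn
  rw [finRotate_apply]
  intro h
  simp at h

/-- In a cycle every point is the start of one edge and the end of one edge, so the factors `B i * A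
j` multiply to the product of all `r`, which cancels. With `n ≥ 2` no edge is a loop. -/
theorem cyclicProd_congr_of_gauge (hn : 2 ≤ n) {d e : Fin n → Fin n → S} {A B r : Fin n → S}
    (hAB : ∀ i, A i * B i = r i) (hr : ∀ i, IsUnit (r i))
    (h : ∀ i j, i ≠ j → d i j * (B i * A j) = e i j * r i) (σ : Equiv.Perm (Fin n)) :
    cyclicProd d σ = cyclicProd e σ := by
  have hprod : IsUnit (∏ i, r (σ i)) := by
    rw [IsUnit.prod_univ_iff]
    exact fun i => hr (σ i)
  apply hprod.mul_right_cancel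
  have h1 : ∏ i, r (σ i) = ∏ i, B (σ i) * A (σ (finRotate n i)) := by
    rw [Finset.prod_mul_distrib, Equiv.prod_comp (finRotate n) fun i => A (σ i),
      ← Finset.prod_mul_distrib]
    exact Finset.prod_congr rfl fun i _ => by rw [← hAB, mul_comm]
  calc cyclicProd d σ * ∏ i, r (σ i) = cyclicProd e σ * ∏ i, r (σ i) := by
        conv_lhs => rw [h1]
        rw [cyclicProd, cyclicProd, ← Finset.prod_mul_distrib, ← Finset.prod_mul_distrib]
        exact Finset.prod_congr rfl fun i _ => h _ _ fun hh =>
          finRotate_apply_ne hn i (σ.injective hh).symm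

theorem cyclicSum_congr {S' : Type*} [CommRing S'] {d : Fin n → Fin n → S'}
    {e : Fin n → Fin n → S} (f : S →+* S') (h : ∀ σ, cyclicProd d σ = f (cyclicProd e σ)) :
    cyclicSum d = f (cyclicSum e) := by
  rw [cyclicSum, cyclicSum]
  refine Eq.trans ?_ (AddMonoidHom.map_finsum f.toAddMonoidHom (Set.toFinite _)).symm
  refine finsum_congr fun q => ?_
  induction q using Quotient.inductionOn'
  exact h _

theorem prod_single {α ι : Type*} [AddCommMonoid α] (s : Finset ι) (m : ι → α) (c : ι → S) :
    ∏ i ∈ s, (AddMonoidAlgebra.single (m i) (c i) : AddMonoidAlgebra S α) =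
      AddMonoidAlgebra.single (∑ i ∈ s, m i) (∏ i ∈ s, c i) := by
  classical
  induction s using Finset.induction_on with
  | empty => simp [AddMonoidAlgebra.one_def]
  | insert i s hi ih =>
    rw [Finset.prod_insert hi, Finset.prod_insert hi, Finset.sum_insert hi, ih,
      AddMonoidAlgebra.single_mul_single]

end KernelFactor

/-! ### Laurent series evaluated at a spectral variable -/

section Laurent

variable {R : Type*} [CommRing R] {n : ℕ}

theorem laurentAt_ofPowerSeries (j : Fin n) (F : PowerSeries R) :
    laurentAt j (HahnSeries.ofPowerSeries ℤ R F) =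
      algebraMap (MvPowerSeries (Fin n) R) (SpecRing R n)
        (MvPowerSeries.rename (R := R) (fun _ : Unit => j) F) :=
  IsLocalization.lift_eq (isUnit_powerSeriesAt j) F

variable [Algebra ℚ R]

theorem C_algebraMap_neg_one_mul (f : LaurentSeries R) :
    HahnSeries.C (algebraMap ℚ R (-1)) * f = -f := by
  rw [map_neg, map_one, HahnSeries.C_mul_eq_smul, neg_smul, one_smul]

theorem rename_resSeries {σ : Type*} (β : ℕ → R) (j : σ) :
    MvPowerSeries.rename (R := R) (fun _ : Unit => j) (resSeries β ()) = resSeries β j := by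
  classical
  ext1 e
  rw [coeff_rename_unit, resSeries, resSeries, coeff_varSeries]
  change (if _ then MvPowerSeries.coeff (Finsupp.single () (e j))
    (varSeries () (PowerSeries.mk β)) else 0) = _
  rw [coeff_varSeries]
  simp [ite_and]

end Laurent

/-! ### The resolvent of a pair of wave functions -/

section Waves

variable {W : Type*} [CommRing W] [Algebra ℚ W] {δ : Derivation ℚ W W} {u : TimeSeries W}
  {a b : LaurentSeries (TimeSeries W)} {n : ℕ}

theorem expDer_one_zero (a : LaurentSeries (TimeSeries W)) :
    expDer δ 1 0 a = laurentDer (xDer δ) a + HahnSeries.single (-1) 1 * a := by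
  simp [expDer, zPow, timeDer]
  rfl

theorem expDer_neg_one_zero (b : LaurentSeries (TimeSeries W)) :
    expDer δ (-1) 0 b = laurentDer (xDer δ) b - HahnSeries.single (-1) 1 * b := by
  have h : ((-1 : ℤ) : ℚ) / (Nat.doubleFactorial (2 * 0 + 1) : ℚ) = -1 := by simp
  rw [expDer, h, C_algebraMap_neg_one_mul, ← sub_eq_add_neg]
  simp only [zPow, Nat.cast_zero, mul_zero, zero_add]
  rfl

/-- Uniqueness of the normalized solution of the resolvent equation identifies `ψψ*` with the
resolvent series of `u`, whichever pair was chosen. -/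
theorem IsWavePair.products (hab : IsWavePair δ u a b) (hu : IsSolution δ u) :
    a * expDer δ (-1) 0 b - expDer δ 1 0 a * b = -2 * HahnSeries.single (-1) 1 ∧
      a * b = HahnSeries.ofPowerSeries ℤ (TimeSeries W) (resSeries (resValue δ u) ()) := by
  obtain ⟨ha, hb⟩ := hab
  have hz2 : (zPow 2 : LaurentSeries (TimeSeries W)) = HahnSeries.single (-1) 1 ^ 2 := by
    rw [zPow, HahnSeries.single_pow]
    simp
  have hla := ha.lax
  have hlb := hb.lax
  rw [laxAct, hz2] at hla hlb
  rw [expDer_one_zero (expDer δ 1 0 a)] at hla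
  rw [expDer_neg_one_zero (expDer δ (-1) 0 b)] at hlb
  obtain ⟨h1, F, hF, hF0, hFr⟩ := wave_products (d := xDer δ) (u := u)
    (T := expDer δ 1 0) rfl expDer_one_zero rfl (expDer_neg_one_zero b)
    (by rw [expDer_one_zero (expDer δ 1 0 a)]; exact hla) hlb
    ha.unitForm.1 ha.unitForm.2 hb.unitForm.1 hb.unitForm.2 hb.residue
  refine ⟨h1, ?_⟩
  rw [hF]
  congr 1
  exact ResolventEq.unique hFr (hu.isKdVFlow.resolventEq ()) hF0
    (hu.isKdVFlow.constantCoeff_resSeries ())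

end Waves

/-! ### Assembly of the two sides of the formula -/

section Main

variable {W : Type*} [CommRing W] [Algebra ℚ W] {δ : Derivation ℚ W W} {u : TimeSeries W}
  {a b : LaurentSeries (TimeSeries W)} {n : ℕ}

theorem isSpectral_algebraMap (δ : Derivation ℚ W W) (n : ℕ) :
    IsSpectral δ (algebraMap (MvPowerSeries (Fin n) (TimeSeries W)) (SpecRing (TimeSeries W) n))
      zVar where
  mul_X := zVar_mul_X
  isUnit_sub _ _ := isUnit_zVar_sq_sub
  exists_der k := exists_derivation_localization
    (nonZeroDivisors (MvPowerSeries (Fin n) (TimeSeries W))) (vertexDer (timeDer δ) k)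

theorem nPointSeries_eq_corrSeries (δ : Derivation ℚ W W) (Ω : ℕ → ℕ → DiffPoly)
    (u : TimeSeries W) (n : ℕ) :
    nPointSeries δ Ω u n =
      corrSeries (fun ps => evalAt δ u (multiOmega Ω ps)) (List.finRange n) := by
  funext e
  rw [nPointSeries, corrSeries]
  simp only [List.mem_finRange, forall_const, not_true_eq_false, false_imp_iff, implies_true,
    and_true, List.ofFn_eq_map]
  congr 2

theorem IsWavePair.cyclicSum_waveD (hab : IsWavePair δ u a b) (hu : IsSolution δ u) (hn : 2 ≤ n) :
    cyclicSum (waveD (n := n) δ a b) = AddMonoidAlgebra.single 0 (cyclicSum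
      (gaugedKernel
        (specRes (algebraMap (MvPowerSeries (Fin n) (TimeSeries W)) (SpecRing (TimeSeries W) n))
          δ u)
        (specResDer (algebraMap (MvPowerSeries (Fin n) (TimeSeries W)) (SpecRing (TimeSeries W) n))
          δ u) zVar)) := by
  have hφ := isSpectral_algebraMap (W := W) δ n
  have hsys := hu.resolventSystem hφ
  obtain ⟨hw, hr⟩ := hab.products hu
  set φ := algebraMap (MvPowerSeries (Fin n) (TimeSeries W)) (SpecRing (TimeSeries W) n)
  have hd : a * expDer δ (-1) 0 b + expDer δ 1 0 a * b = HahnSeries.ofPowerSeries ℤ (TimeSeries W)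
      (coeffDer Unit (xDer δ) (resSeries (resValue δ u) ())) := by
    rw [← laurentDer_ofPowerSeries, ← hr, laurentDer_mul, expDer_one_zero, expDer_neg_one_zero]
    ring
  have hAB : ∀ i : Fin n, laurentAt i a * laurentAt i b = specRes φ δ u i := fun i => by
    rw [← map_mul, hr, laurentAt_ofPowerSeries, rename_resSeries]
    rfl
  have hsum : ∀ i : Fin n, laurentAt i a * laurentAt i (expDer δ (-1) 0 b)
      + laurentAt i (expDer δ 1 0 a) * laurentAt i b = specResDer φ δ u i := fun i => by
    rw [← map_mul, ← map_mul, ← map_add, hd, laurentAt_ofPowerSeries, coeffDer_rename,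
      rename_resSeries]
    rfl
  have hsub : ∀ i : Fin n, laurentAt i a * laurentAt i (expDer δ (-1) 0 b)
      - laurentAt i (expDer δ 1 0 a) * laurentAt i b = -2 * zVar i := fun i => by
    rw [← map_mul, ← map_mul, ← map_sub, hw, map_mul, map_neg, map_ofNat, zVar]
  have hD : ∀ i j : Fin n, waveD δ a b i j = AddMonoidAlgebra.single
      (Pi.single i 1 + Pi.single j (-1)) (Ring.inverse (zVar j ^ 2 - zVar i ^ 2) *
        (laurentAt i a * laurentAt j (expDer δ (-1) 0 b)
          - laurentAt j b * laurentAt i (expDer δ 1 0 a))) := fun i j => by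
    rw [waveD, waveAt, waveAt, waveAt, waveAt, AddMonoidAlgebra.single_mul_single,
      AddMonoidAlgebra.single_mul_single, add_comm (Pi.single j (-1)) (Pi.single i 1),
      ← AddMonoidAlgebra.single_sub, AddMonoidAlgebra.smul_single, smul_eq_mul]
  refine cyclicSum_congr (AddMonoidAlgebra.singleZeroRingHom :
    SpecRing (TimeSeries W) n →+* ExpRing (TimeSeries W) n) fun σ => ?_
  rw [← cyclicProd_congr_of_gauge hn hAB hsys.isUnit_r fun i j hij =>
    inverse_mul_eq_gaugedKernel hAB hsum hsub hsys.isUnit_two (hsys.isUnit_r i)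
      (hsys.isUnit_sub i j hij)]
  -- The exponent of `waveD δ a b i j` is `θ(z_i) - θ(z_j)`; these differences add up to zero around
  -- a cycle, so the product lies in the component without exponential.
  rw [cyclicProd, Finset.prod_congr rfl fun i _ => hD _ _, prod_single, Finset.sum_add_distrib,
    Equiv.sum_comp (finRotate n) fun i => (Pi.single (σ i) (-1) : Fin n → ℤ),
    ← Finset.sum_add_distrib]
  simp only [← Pi.single_add, add_neg_cancel, Pi.single_zero, Finset.sum_const_zero]
  rfl

end Main

end KdV

end

theorem theorem1 {W : Type*} [CommRing W] [Algebra ℚ W] (δ : Derivation ℚ W W)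
    (V : Subring W) (hV : ∀ f ∈ V, δ f ∈ V) (hVW : ∀ f ∈ V, ∃ g, δ g = f)
    (u : KdV.TimeSeries W) (huV : ∀ m, MvPowerSeries.coeff m u ∈ V) (hu : KdV.IsSolution δ u)
    (a b : LaurentSeries (KdV.TimeSeries W)) (hab : KdV.IsWavePair δ u a b)
    (Ω : ℕ → ℕ → KdV.DiffPoly) (hΩ : KdV.IsCanonicalTauStructure Ω)
    (n : ℕ) (hn : 2 ≤ n) :
    AddMonoidAlgebra.single 0 (algebraMap (MvPowerSeries (Fin n) (KdV.TimeSeries W))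
        (KdV.SpecRing (KdV.TimeSeries W) n) (KdV.nPointSeries δ Ω u n)) =
      (-1) ^ (n - 1) * KdV.cyclicSum (KdV.waveD δ a b)
        - AddMonoidAlgebra.single 0 (if n = 2 then
            Ring.inverse ((KdV.zVar ⟨0, by omega⟩ - KdV.zVar ⟨1, by omega⟩) ^ 2) else 0) := by
  obtain ⟨m, rfl⟩ := Nat.exists_eq_add_of_le' hn
  have hlist : ∀ k, List.finRange (k + 1) = (List.finRange k).map Fin.castSucc ++ [Fin.last k] :=
    fun k => List.finRange_succ_last
  have hsplit : (List.finRange (m + 1)).map Fin.castSucc =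
      ((List.finRange m).map Fin.castSucc).map Fin.castSucc ++ [(Fin.last m).castSucc] := by
    rw [hlist m, List.map_append, List.map_singleton]
  -- The last two points are the ones of the initial two-point function, and the very last is the
  -- base point of the cycles. The others are inserted from right to left, as `multiOmega` applies
  -- its derivations.
  have hfull : List.finRange (m + 2) = ((List.finRange m).map Fin.castSucc).map Fin.castSucc
      ++ [(Fin.last m).castSucc, Fin.last (m + 1)] := by
    rw [hlist (m + 1), hsplit, List.append_assoc, List.singleton_append]
  have hφ := KdV.isSpectral_algebraMap (W := W) δ (m + 2)
  have key := hΩ.specCorr_eq_cycleSum hu hφ _ (hfull ▸ List.nodup_finRange (m + 2))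
  rw [← hfull, ← hsplit, ← KdV.cyclicSum_eq_cycleSum] at key
  rw [hab.cyclicSum_waveD hu hn, KdV.nPointSeries_eq_corrSeries]
  have hsgn : ((-1) ^ (m + 2 - 1) : KdV.ExpRing (KdV.TimeSeries W) (m + 2)) =
      AddMonoidAlgebra.single 0 ((-1) ^ (m + 1)) := by
    have h := map_pow (AddMonoidAlgebra.singleZeroRingHom :
      KdV.SpecRing (KdV.TimeSeries W) (m + 2) →+* KdV.ExpRing (KdV.TimeSeries W) (m + 2))
      (-1) (m + 1)
    rw [map_neg, map_one] at h
    exact h.symm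
  rw [hsgn, AddMonoidAlgebra.single_mul_single, add_zero, ← AddMonoidAlgebra.single_sub]
  congr 1
  refine key.trans ?_
  simp only [List.length_map, List.length_finRange]
  congr 1
  cases m with
  | zero => rfl
  | succ m =>
    rw [if_neg (by simp), if_neg (by omega)]
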